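/- **Setting.** Let $G\subset SL(N,\mathbb R)$ be a closed connected subgroup with Lie algebra $\mathfrak g$, let $\Gamma\subset G$ be a lattice (a discrete subgroup such that $X=\Gamma\backslash G$ carries a $G$-invariant Borel probability measure), and let $G$ act on $X$ by $g.(\Gamma h)=\Gamma hg^{-1}$. Let $a\in G$ be of class $\mathscr A$: $a$ is conjugate in $SL(N,\mathbb R)$ to a diagonal matrix, no eigenvalue of $\mathrm{Ad}_a$ on $\mathfrak g$ other than $1$ has absolute value $1$, and no two different eigenvalues of $\mathrm{Ad}_a$ have the same absolute value. Put $T:X\to X$, $T(x)=a.x$. Let $\mathfrak g_0$ be the eigenspace of $\mathrm{Ad}_a$ for the eigenvalue $1$, and let $\mathfrak g_+$ (resp. $\mathfrak g_-$) be the sum of the eigenspaces with eigenvalues of absolute value $>1$ (resp. $<1$). Let $G^+=\{g\in G: a^lga^{-l}\to e \text{ as } l\to-\infty\}$. Fix a basis of $\mathfrak g_+$ and bases of $\mathfrak g_0$, $\mathfrak g_-$ consisting of eigenvectors of $\mathrm{Ad}_a$, and let $B^+_s,B^0_s,B^-_s$ be the open balls of radius $s$ about $0$ for the corresponding sup norms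 of coordinates. A Borel probability measure $\mu$ on $X$ has *local dimension* $\kappa>0$ *in the unstable horospherical direction* if it has compact support and there are $s_0>0$, a finite Borel measure $\lambda$ on $X$ and a constant $C$ such that $$\mu\big(\exp(B_s^-)\exp(B_s^0)\exp(B^+_{\delta\tilde s}+u).x\big)\le C\,\delta^{\kappa}\,\lambda\big(\exp(B_s^-)\exp(B_s^0)\exp(B^+_{\tilde s}+u).x\big)$$ for all $0<\tilde s\le s<s_0$, $u\in B_s^+$ with $B^+_{\tilde s}+u\subset B_s^+$, $0<\delta<1$ and $x\in\mathrm{supp}(\mu)$. **Theorem.** Suppose that $G^+$ is abelian and that $\mathfrak g_+$ is a (nonzero) eigenspace of $\mathrm{Ad}_a$, with eigenvalue of absolute value $e^t$. Let $\mu$ be a Borel probability measure on $X$ which has local dimension $\kappa$ in the unstable horospherical direction for some $\kappa>0$, and let the Radon measure $\rho$ be a limit point, in the weak$^*$ topology (tested against $C_c(X)$), of the sequence $\frac1k\sum_{l=0}^{k-1}T^l_*\mu$, with $\rho(X)>0$. Then $\nu=\rho/\rho(X)$ is a $T$-invariant probability measure and its measure-theoretic entropy satisfies $h_\nu(T)\ge\kappa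 t$. -/

import Mathlib

open Filter Topology MeasureTheory
open scoped ENNReal NNReal CompactlySupported

noncomputable section

namespace HomDyn

/-! ### Entropy of a measure preserving map -/

section Entropy

variable {Ω ι : Type*} [MeasurableSpace Ω]

/-- The entropy `H_ν(P) = ∑_{P ∈ 𝒫} ν(P) (-log ν(P))` of a countable partition `𝒫`. The partition
is given by its labelling `ξ : Ω → ι`; its cells are the non-empty fibres of `ξ` (an empty fibre
contributes `0`). -/
def partitionEntropy (ν : Measure Ω) (ξ : Ω → ι) : ℝ≥0∞ :=
  ∑' c : ι, ENNReal.ofReal (Real.negMulLog (ν.real (ξ ⁻¹' {c})))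

/-- The labelling of the common refinement `⋁_{i < m} T⁻ⁱ 𝒫`: its cells are the non-empty sets
`P₀ ∩ T⁻¹ P₁ ∩ ⋯ ∩ T^{-(m-1)} P_{m-1}`. -/
def itinerary (T : Ω → Ω) (ξ : Ω → ι) (m : ℕ) : Ω → (Fin m → ι) :=
  fun x i => ξ (T^[(i : ℕ)] x)

/-- `h_ν(T, 𝒫) = lim_m (1/m) H_ν(⋁_{i < m} T⁻ⁱ 𝒫)`. For a `T`-invariant probability measure and a
partition of finite entropy the limit exists by subadditivity, hence equals the lower limit. -/
def entropyOfPartition (T : Ω → Ω) (ν : Measure Ω) (ξ : Ω → ι) : ℝ≥0∞ :=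
  liminf (fun m : ℕ => partitionEntropy ν (itinerary T ξ m) / (m : ℝ≥0∞)) atTop

/-- The (Kolmogorov-Sinai) entropy `h_ν(T)`: the supremum of `h_ν(T, 𝒫)` over the finite or
countable measurable partitions `𝒫` with `H_ν(𝒫) < ∞`. -/
def measureEntropy (T : Ω → Ω) (ν : Measure Ω) : ℝ≥0∞ :=
  ⨆ (ξ : Ω → ℕ) (_ : Measurable ξ) (_ : partitionEntropy ν ξ < ∞), entropyOfPartition T ν ξ

end Entropy

/-! ### Averages and weak-* limit points -/

section Averages

variable {X : Type*} [MeasurableSpace X]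

/-- The Cesàro average `(1/k) ∑_{l < k} T^l_* μ`. -/
def cesaroAverage (T : X → X) (μ : Measure X) (k : ℕ) : Measure X :=
  (k : ℝ≥0∞)⁻¹ • ∑ l ∈ Finset.range k, μ.map (T^[l])

/-- `ρ` is a limit point of the sequence `μs` of measures in the weak-* topology, that is, in the
topology of pointwise convergence of the functionals `f ↦ ∫ f dρ` on `C_c(X)`. -/
def IsWeakStarLimitPoint [TopologicalSpace X] (ρ : Measure X) (μs : ℕ → Measure X) : Prop :=
  MapClusterPt (fun f : C_c(X, ℝ) => ∫ x, f x ∂ρ) atTop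
    (fun k : ℕ => fun f : C_c(X, ℝ) => ∫ x, f x ∂(μs k))

end Averages

/-! ### The homogeneous space `Γ \ G` -/

section HomogeneousSpace

variable {G : Type*} [Group G]

/-- The space `X = Γ \ G` of cosets `Γ h`. -/
def CosetSpace (Γ : Subgroup G) : Type _ := Quotient (QuotientGroup.rightRel Γ)

/-- The action `g.(Γ h) = Γ (h g⁻¹)` of `G` on `Γ \ G`. -/
instance (Γ : Subgroup G) : MulAction G (CosetSpace Γ) where
  smul g := Quotient.map (fun h => h * g⁻¹) (by
    intro x y hxy
    have h' : y * x⁻¹ ∈ Γ := QuotientGroup.rightRel_apply.1 hxy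
    refine QuotientGroup.rightRel_apply.2 ?_
    simpa [mul_assoc] using h')
  one_smul := by
    rintro ⟨h⟩
    exact congrArg (Quotient.mk _) (by simp)
  mul_smul := by
    rintro g g' ⟨h⟩
    exact congrArg (Quotient.mk _) (by simp [mul_assoc])

instance [TopologicalSpace G] (Γ : Subgroup G) : TopologicalSpace (CosetSpace Γ) :=
  inferInstanceAs (TopologicalSpace (Quotient _))

instance [TopologicalSpace G] (Γ : Subgroup G) : MeasurableSpace (CosetSpace Γ) :=
  borel _

instance [TopologicalSpace G] (Γ : Subgroup G) : BorelSpace (CosetSpace Γ) :=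
  ⟨rfl⟩

/-- `Γ` is a lattice: it is discrete and `Γ \ G` carries a `G`-invariant Borel probability
measure. -/
def IsLattice [TopologicalSpace G] (Γ : Subgroup G) : Prop :=
  DiscreteTopology Γ ∧
    ∃ m : Measure (CosetSpace Γ), IsProbabilityMeasure m ∧
      ∀ g : G, m.map (fun x => g • x) = m

/-- The unstable horospherical subgroup
`G⁺ = {g : a^l g a^{-l} → e as l → -∞}` of `a`. -/
def unstableHorospherical [TopologicalSpace G] [IsTopologicalGroup G] (a : G) : Subgroup G where
  carrier := {g | Tendsto (fun l : ℤ => a ^ l * g * a ^ (-l)) atBot (𝓝 1)}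
  one_mem' := by simp [tendsto_const_nhds]
  mul_mem' := by
    intro g h hg hh
    have := Tendsto.mul hg hh
    rw [mul_one] at this
    refine this.congr fun l => ?_
    group
  inv_mem' := by
    intro g hg
    have := Tendsto.inv hg
    rw [inv_one] at this
    refine this.congr fun l => ?_
    group

end HomogeneousSpace

/-! ### The Lie algebra of a closed linear group -/

/-- If a curve `c` through `1` has velocity `Z` at time `0`, then `c(1/n)^n → exp Z`. -/
theorem tendsto_pow_exp_of_hasDerivAt {A : Type*} [NormedRing A] [NormedAlgebra ℝ A]
    [CompleteSpace A] {c : ℝ → A} {Z : A} (h0 : c 0 = 1) (hc : HasDerivAt c Z 0) :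
    Tendsto (fun n : ℕ => c ((n : ℝ)⁻¹) ^ n) atTop (𝓝 (NormedSpace.exp Z)) := by
  let _ : NormedAlgebra ℚ A := NormedAlgebra.restrictScalars ℚ ℝ A
  have he : HasStrictFDerivAt (NormedSpace.exp : A → A)
      ((ContinuousLinearEquiv.refl ℝ A : A ≃L[ℝ] A) : A →L[ℝ] A) 0 :=
    hasStrictFDerivAt_exp_zero (𝕂 := ℝ)
  have hL := he.to_localInverse.hasFDerivAt
  have hr := he.eventually_right_inverse
  have hL0 : he.localInverse NormedSpace.exp _ 0 1 = 0 := by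
    simpa using he.localInverse_apply_image
  rw [NormedSpace.exp_zero] at hL hr
  set L := he.localInverse NormedSpace.exp _ 0 with hLdef
  rw [← h0] at hL
  have hd : HasDerivAt (L ∘ c) Z 0 := by
    simpa using hL.comp_hasDerivAt (0 : ℝ) hc
  have hinv : Tendsto (fun n : ℕ => ((n : ℝ)⁻¹)) atTop (𝓝[≠] 0) := by
    refine tendsto_nhdsWithin_iff.2 ⟨tendsto_inv_atTop_nhds_zero_nat, ?_⟩
    filter_upwards [eventually_gt_atTop 0] with n hn
    have : (n : ℝ) ≠ 0 := by positivity
    simpa using this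
  have hs := (hasDerivAt_iff_tendsto_slope.1 hd).comp hinv
  have hs' : Tendsto (fun n : ℕ => n • L (c ((n : ℝ)⁻¹))) atTop (𝓝 Z) := by
    refine hs.congr fun n => ?_
    simp [slope, h0, hL0, Nat.cast_smul_eq_nsmul]
  have hcont : Tendsto (fun n : ℕ => NormedSpace.exp (n • L (c ((n : ℝ)⁻¹)))) atTop
      (𝓝 (NormedSpace.exp Z)) :=
    (NormedSpace.exp_continuous.tendsto Z).comp hs'
  have hcn : Tendsto (fun n : ℕ => c ((n : ℝ)⁻¹)) atTop (𝓝 1) := by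
    have := hc.continuousAt.tendsto.comp (hinv.mono_right nhdsWithin_le_nhds)
    rwa [h0] at this
  refine hcont.congr' ?_
  filter_upwards [hcn.eventually hr] with n hn
  rw [NormedSpace.exp_nsmul, hn]

/-- The Lie product formula. -/
theorem tendsto_exp_mul_exp_pow {A : Type*} [NormedRing A] [NormedAlgebra ℝ A]
    [CompleteSpace A] (X Y : A) :
    Tendsto (fun n : ℕ => (NormedSpace.exp ((n : ℝ)⁻¹ • X) * NormedSpace.exp ((n : ℝ)⁻¹ • Y)) ^ n)
      atTop (𝓝 (NormedSpace.exp (X + Y))) := by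
  have h1 := hasDerivAt_exp_smul_const (𝕂 := ℝ) X 0
  have h2 := hasDerivAt_exp_smul_const (𝕂 := ℝ) Y 0
  have h3 : HasDerivAt ((fun s : ℝ => NormedSpace.exp (s • X)) *
      (fun s : ℝ => NormedSpace.exp (s • Y))) (X + Y) 0 := by
    simpa using h1.mul h2
  exact tendsto_pow_exp_of_hasDerivAt (by simp) h3

theorem matrix_tendsto_exp_mul_exp_pow {N : ℕ} (X Y : Matrix (Fin N) (Fin N) ℝ) :
    Tendsto (fun n : ℕ => (NormedSpace.exp ((n : ℝ)⁻¹ • X) * NormedSpace.exp ((n : ℝ)⁻¹ • Y)) ^ n)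
      atTop (𝓝 (NormedSpace.exp (X + Y))) := by
  let _ := Matrix.linftyOpNormedRing (n := Fin N) (α := ℝ)
  let _ := Matrix.linftyOpNormedAlgebra (n := Fin N) (R := ℝ) (α := ℝ)
  exact tendsto_exp_mul_exp_pow X Y

section LieAlgebra

variable {N : ℕ} {G : Subgroup (Matrix.SpecialLinearGroup (Fin N) ℝ)}

/-- A closed linear group is closed in the space of all matrices. -/
theorem isClosed_image_val (hG : IsClosed (G : Set (Matrix.SpecialLinearGroup (Fin N) ℝ))) :
    IsClosed {M : Matrix (Fin N) (Fin N) ℝ |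
      ∃ g ∈ G, (g : Matrix (Fin N) (Fin N) ℝ) = M} :=
  Matrix.SpecialLinearGroup.isClosedEmbedding_val.isClosedMap _ hG

/-- The Lie algebra `𝔤 = {X : exp(sX) ∈ G for all real s}` of a closed subgroup `G` of
`SL(N, ℝ)`. -/
def lieAlg (hG : IsClosed (G : Set (Matrix.SpecialLinearGroup (Fin N) ℝ))) :
    Submodule ℝ (Matrix (Fin N) (Fin N) ℝ) where
  carrier := {X | ∀ s : ℝ, ∃ g ∈ G,
    (g : Matrix (Fin N) (Fin N) ℝ) = NormedSpace.exp (s • X)}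
  zero_mem' := fun s => ⟨1, G.one_mem, by simp⟩
  smul_mem' := fun c X hX s => by simpa [smul_smul] using hX (s * c)
  add_mem' := by
    intro X Y hX hY s
    rw [smul_add]
    refine (isClosed_image_val hG).mem_of_tendsto
      (matrix_tendsto_exp_mul_exp_pow (s • X) (s • Y)) (Eventually.of_forall fun n => ?_)
    obtain ⟨g, hg, hgX⟩ := hX ((n : ℝ)⁻¹ * s)
    obtain ⟨h, hh, hhY⟩ := hY ((n : ℝ)⁻¹ * s)
    refine ⟨(g * h) ^ n, G.pow_mem (G.mul_mem hg hh) n, ?_⟩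
    simp [hgX, hhY, smul_smul]

variable (hG : IsClosed (G : Set (Matrix.SpecialLinearGroup (Fin N) ℝ)))

/-- The exponential map `𝔤 → G`. -/
def expG (x : lieAlg hG) : G :=
  ⟨⟨NormedSpace.exp (x : Matrix (Fin N) (Fin N) ℝ), by
      obtain ⟨g, -, h⟩ := x.2 1
      rw [one_smul] at h
      rw [← h]
      exact g.2⟩, by
    obtain ⟨g, hg, h⟩ := x.2 1
    rw [one_smul] at h
    have hgx : (⟨NormedSpace.exp (x : Matrix (Fin N) (Fin N) ℝ), by rw [← h]; exact g.2⟩ :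
        Matrix.SpecialLinearGroup (Fin N) ℝ) = g := Subtype.ext h.symm
    exact (congrArg (· ∈ G) hgx).mpr hg⟩

/-- The adjoint action `Ad_a X = a X a⁻¹` of `a ∈ G` on `𝔤`. -/
def Ad (a : G) : Module.End ℝ (lieAlg hG) where
  toFun x := ⟨((a : Matrix.SpecialLinearGroup (Fin N) ℝ) : Matrix (Fin N) (Fin N) ℝ) * x *
      ((a⁻¹ : G) : Matrix.SpecialLinearGroup (Fin N) ℝ), by
    intro s
    obtain ⟨g, hg, h⟩ := x.2 s
    refine ⟨a * g * (a⁻¹ : G), G.mul_mem (G.mul_mem a.2 hg) (a⁻¹).2, ?_⟩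
    have hdet : IsUnit
        ((a : Matrix.SpecialLinearGroup (Fin N) ℝ) : Matrix (Fin N) (Fin N) ℝ).det := by
      simp
    have hinv : (((a⁻¹ : G) : Matrix.SpecialLinearGroup (Fin N) ℝ) :
        Matrix (Fin N) (Fin N) ℝ) =
        ((a : Matrix.SpecialLinearGroup (Fin N) ℝ) : Matrix (Fin N) (Fin N) ℝ)⁻¹ := by
      refine (Matrix.inv_eq_right_inv ?_).symm
      rw [← Matrix.SpecialLinearGroup.coe_mul]
      simp
    have := Matrix.exp_conj
      ((a : Matrix.SpecialLinearGroup (Fin N) ℝ) : Matrix (Fin N) (Fin N) ℝ)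
      (s • (x : Matrix (Fin N) (Fin N) ℝ)) ((Matrix.isUnit_iff_isUnit_det _).2 hdet)
    rw [Matrix.SpecialLinearGroup.coe_mul, Matrix.SpecialLinearGroup.coe_mul, h, hinv, ← this]
    congr 1
    simp⟩
  map_add' x y := Subtype.ext (by simp [mul_add, add_mul])
  map_smul' c x := Subtype.ext (by simp)

/-- `𝔤₊`: the sum of the eigenspaces of `Ad_a` with eigenvalues greater than `1` in absolute
value. -/
def gPlus (a : G) : Submodule ℝ (lieAlg hG) :=
  ⨆ (lam : ℝ) (_ : 1 < |lam|), (Ad hG a).eigenspace lam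

/-- `𝔤₀`: the eigenspace of `Ad_a` for the eigenvalue `1`. -/
def gZero (a : G) : Submodule ℝ (lieAlg hG) :=
  (Ad hG a).eigenspace 1

/-- `𝔤₋`: the sum of the eigenspaces of `Ad_a` with eigenvalues less than `1` in absolute
value. -/
def gMinus (a : G) : Submodule ℝ (lieAlg hG) :=
  ⨆ (lam : ℝ) (_ : |lam| < 1), (Ad hG a).eigenspace lam

/-- `a` is of class `𝒜`: it is conjugate in `SL(N, ℝ)` to a diagonal matrix, `1` is the only
eigenvalue of `Ad_a` of absolute value `1`, and distinct eigenvalues of `Ad_a` have distinct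
absolute values. -/
structure IsClassA (a : G) : Prop where
  semisimple : ∃ (p : Matrix.SpecialLinearGroup (Fin N) ℝ) (d : Fin N → ℝ),
    ((p * a * p⁻¹ : Matrix.SpecialLinearGroup (Fin N) ℝ) : Matrix (Fin N) (Fin N) ℝ) =
      Matrix.diagonal d
  eq_one : ∀ lam : ℝ, (Ad hG a).HasEigenvalue lam → |lam| = 1 → lam = 1
  eq_of_abs_eq : ∀ lam lam' : ℝ, (Ad hG a).HasEigenvalue lam → (Ad hG a).HasEigenvalue lam' →
    |lam| = |lam'| → lam = lam'

/-- The open ball with centre `c` and radius `r` for the sup norm of coordinates in the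
basis `b`. -/
def supBall {V : Type*} [AddCommGroup V] [Module ℝ V] {n : ℕ} (b : Module.Basis (Fin n) ℝ V)
    (c : V) (r : ℝ) : Set V :=
  {z | ‖b.equivFun (z - c)‖ < r}

variable {hG} {a : G} {nm nz np : ℕ}

/-- The set `exp(B⁻_s) exp(B⁰_s) exp(B⁺_r + u) ⊆ G`. -/
def tube (bm : Module.Basis (Fin nm) ℝ (gMinus hG a))
    (b0 : Module.Basis (Fin nz) ℝ (gZero hG a))
    (bp : Module.Basis (Fin np) ℝ (gPlus hG a))
    (s r : ℝ) (u : gPlus hG a) : Set G :=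
  {g | ∃ (x : gMinus hG a) (y : gZero hG a) (z : gPlus hG a),
    x ∈ supBall bm 0 s ∧ y ∈ supBall b0 0 s ∧ z ∈ supBall bp u r ∧
    g = expG hG x * expG hG y * expG hG z}

/-- `μ` has local dimension `κ` in the unstable horospherical direction (with respect to the
given bases of `𝔤₋`, `𝔤₀` and `𝔤₊`): it has compact support, and there are `s₀ > 0`, a finite
measure `lam` and a constant `C` such that
`μ(exp(B⁻_s) exp(B⁰_s) exp(B⁺_{δ s'} + u).x) ≤ C δ^κ lam(exp(B⁻_s) exp(B⁰_s) exp(B⁺_{s'} + u).x)`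
whenever `0 < s' ≤ s < s₀`, `u ∈ B⁺_s`, `B⁺_{s'} + u ⊆ B⁺_s`, `0 < δ < 1` and `x ∈ supp μ`. -/
def HasLocalDimension (bm : Module.Basis (Fin nm) ℝ (gMinus hG a))
    (b0 : Module.Basis (Fin nz) ℝ (gZero hG a))
    (bp : Module.Basis (Fin np) ℝ (gPlus hG a))
    {Γ : Subgroup G} (μ : Measure (CosetSpace Γ)) (κ : ℝ) : Prop :=
  IsCompact μ.support ∧
    ∃ s₀ : ℝ, 0 < s₀ ∧ ∃ lam : Measure (CosetSpace Γ), IsFiniteMeasure lam ∧ ∃ C : ℝ≥0,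
      ∀ (s s' δ : ℝ) (u : gPlus hG a) (x : CosetSpace Γ),
        0 < s' → s' ≤ s → s < s₀ → u ∈ supBall bp 0 s → supBall bp u s' ⊆ supBall bp 0 s →
        0 < δ → δ < 1 → x ∈ μ.support →
        μ ((fun g : G => g • x) '' tube bm b0 bp s (δ * s') u) ≤
          (C : ℝ≥0∞) * ENNReal.ofReal (δ ^ κ) *
            lam ((fun g : G => g • x) '' tube bm b0 bp s s' u)

end LieAlgebra

end HomDyn

end

open HomDyn

/-!
Near `x` the points whose first `n` iterates under `a` stay close to those of `x` are the `g • x`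
with `g` in the Bowen set of order `n`: the conjugates of `g` by `1, a, …, aⁿ` stay near `1`. As
`Ad_a` multiplies `𝔤₊` by `lam` and expands no other direction, such a set is comparable to a box of
size `1` along `𝔤₋ ⊕ 𝔤₀` and `|lam|⁻ⁿ` along `𝔤₊`. The preimage of a Bowen set under `aˡ` is covered
by boxes of size `|lam|⁻ˡ⁻ⁿ` along `𝔤₊`, centred at a maximal separated subset of the support of
`μ`. Local dimension bounds the measure of each by `O(|lam|^(-κn))` times a finite measure of the
box of size `|lam|⁻ˡ` around it, and those larger boxes have bounded multiplicity. So `Tˡ_*μ` gives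
Bowen sets measure `O(|lam|^(-κn))` uniformly in `l`, and this passes to averages and, Bowen sets
being open, to the limit point.

To read off the entropy, partition the space into the complement of a compact set `Q` and small
pieces of `Q`. The Bowen sets of order `n + 1` needed to cover one of order `n` are at most `K` in
number, so a cylinder of length `n` lies in a union of at most `K ^ j` Bowen sets, where `j` is its
number of visits to `Qᶜ`. The entropy is therefore at least `κ log |lam| - ν(Qᶜ) log K`, and `Q`
exhausts the space.
-/

open scoped Pointwise

namespace HomDyn

/-! ### Entropy and the measure of cylinders -/

theorem count_iterate_eq_sum_indicator {Ω : Type*} (T : Ω → Ω) (p : Ω → Prop) [DecidablePred p]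
    (m : ℕ) (x : Ω) : (Nat.count (fun i => p (T^[i] x)) m : ℝ) =
      ∑ i ∈ Finset.range m, (T^[i] ⁻¹' {y | p y}).indicator 1 x := by
  rw [Nat.count_eq_card_filter_range, Finset.card_filter, Nat.cast_sum]
  exact Finset.sum_congr rfl fun i _ => by simp [Set.indicator]

theorem itinerary_preimage_itinerary {Ω ι : Type*} (T : Ω → Ω) (ξ : Ω → ι) (m : ℕ) (x : Ω) :
    itinerary T ξ m ⁻¹' {itinerary T ξ m x} = {y | ∀ i < m, ξ (T^[i] y) = ξ (T^[i] x)} := by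
  ext y
  simp only [Set.mem_preimage, Set.mem_singleton_iff, Set.mem_ofPred_eq, funext_iff, itinerary,
    Fin.forall_iff]

section Entropy

variable {Ω ι : Type*} [MeasurableSpace Ω] {ν : Measure Ω}

theorem partitionEntropy_eq_lintegral_neg_log [Countable ι] [MeasurableSpace ι]
    [MeasurableSingletonClass ι] [IsFiniteMeasure ν] {η : Ω → ι} (hη : Measurable η) :
    partitionEntropy ν η =
      ∫⁻ x, ENNReal.ofReal (-Real.log (ν.real (η ⁻¹' {η x}))) ∂ν := by
  have hmeas : Measurable fun c => ENNReal.ofReal (-Real.log (ν.real (η ⁻¹' {c}))) :=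
    .of_discrete
  rw [← lintegral_map hmeas hη, lintegral_countable', partitionEntropy]
  refine tsum_congr fun c => ?_
  rw [Measure.map_apply hη (measurableSet_singleton c), Real.negMulLog, neg_mul_comm, mul_comm,
    ENNReal.ofReal_mul' measureReal_nonneg, ofReal_measureReal]

theorem ofReal_integral_le_lintegral_ofReal {g : Ω → ℝ} (hg : Integrable g ν) :
    ENNReal.ofReal (∫ x, g x ∂ν) ≤ ∫⁻ x, ENNReal.ofReal (g x) ∂ν := by
  calc ENNReal.ofReal (∫ x, g x ∂ν)
      ≤ ENNReal.ofReal (∫ x, max (g x) 0 ∂ν) :=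
        ENNReal.ofReal_le_ofReal (integral_mono hg hg.pos_part fun x => le_max_left _ _)
    _ = ∫⁻ x, ENNReal.ofReal (g x) ∂ν := by
        rw [ofReal_integral_eq_lintegral_ofReal hg.pos_part
          (Eventually.of_forall fun x => le_max_right _ _)]
        simp only [ENNReal.ofReal_max, ENNReal.ofReal_zero, zero_le, sup_of_le_left]

theorem ofReal_integral_le_partitionEntropy [Countable ι] [MeasurableSpace ι]
    [MeasurableSingletonClass ι] [IsFiniteMeasure ν] {η : Ω → ι} (hη : Measurable η)
    {g : Ω → ℝ} (hg : Integrable g ν) (h : ∀ x, ν.real (η ⁻¹' {η x}) ≤ Real.exp (-g x)) :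
    ENNReal.ofReal (∫ x, g x ∂ν) ≤ partitionEntropy ν η := by
  have hcell : ∀ᵐ x ∂ν, 0 < ν.real (η ⁻¹' {η x}) := by
    refine ae_of_ae_map (p := fun c => 0 < ν.real (η ⁻¹' {c})) hη.aemeasurable
      (ae_iff_of_countable.2 fun c hc => ?_)
    rw [Measure.map_apply hη (measurableSet_singleton c)] at hc
    exact ENNReal.toReal_pos hc (measure_ne_top ν _)
  rw [partitionEntropy_eq_lintegral_neg_log hη]
  refine (ofReal_integral_le_lintegral_ofReal hg).trans (lintegral_mono_ae ?_)
  filter_upwards [hcell] with x hx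
  refine ENNReal.ofReal_le_ofReal ?_
  linarith [(Real.log_le_iff_le_exp hx).2 (h x)]

theorem partitionEntropy_lt_top_of_le {ξ : Ω → ℕ} {R : ℕ} (hR : ∀ x, ξ x ≤ R) :
    partitionEntropy ν ξ < ∞ := by
  rw [partitionEntropy, tsum_eq_sum (s := Finset.range (R + 1))]
  · exact ENNReal.sum_lt_top.2 fun _ _ => ENNReal.ofReal_lt_top
  · intro c hc
    have hempty : ξ ⁻¹' {c} = ∅ := Set.eq_empty_of_forall_notMem fun x hx => hc <|
      Finset.mem_range.2 <| (Set.mem_singleton_iff.1 hx) ▸ Nat.lt_succ_of_le (hR x)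
    simp [hempty]

theorem measurable_itinerary [MeasurableSpace ι] {T : Ω → Ω} (hT : Measurable T) {ξ : Ω → ι}
    (hξ : Measurable ξ) (m : ℕ) : Measurable (itinerary T ξ m) :=
  measurable_pi_lambda _ fun i => hξ.comp (hT.iterate i)

variable [IsFiniteMeasure ν] {T : Ω → Ω}

theorem integrable_count_iterate (hT : Measurable T) {p : Ω → Prop} [DecidablePred p]
    (hp : MeasurableSet {x | p x}) (m : ℕ) :
    Integrable (fun x => (Nat.count (fun i => p (T^[i] x)) m : ℝ)) ν := by
  simp only [count_iterate_eq_sum_indicator]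
  exact integrable_finsetSum _ fun i _ => (integrable_const 1).indicator (hT.iterate i hp)

theorem integral_count_iterate (hT : MeasurePreserving T ν ν) {p : Ω → Prop}
    [DecidablePred p] (hp : MeasurableSet {x | p x}) (m : ℕ) :
    ∫ x, (Nat.count (fun i => p (T^[i] x)) m : ℝ) ∂ν = m * ν.real {x | p x} := by
  have hm : ∀ i, MeasurableSet (T^[i] ⁻¹' {x | p x}) := fun i => hT.measurable.iterate i hp
  have hinv : ∀ i, ν.real (T^[i] ⁻¹' {x | p x}) = ν.real {x | p x} := fun i =>
    (hT.iterate i).measureReal_preimage hp.nullMeasurableSet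
  simp only [count_iterate_eq_sum_indicator]
  rw [integral_finsetSum _ fun i _ => (integrable_const 1).indicator (hm i)]
  simp only [integral_indicator_one (hm _), hinv, Finset.sum_const, Finset.card_range,
    nsmul_eq_mul]

end Entropy

section Entropy

variable {Ω : Type*} [MeasurableSpace Ω] {ν : Measure Ω} [IsProbabilityMeasure ν] {T : Ω → Ω}
  {ξ : Ω → ℕ} {C K θ : ℝ}

theorem partitionEntropy_itinerary_ge (hT : MeasurePreserving T ν ν) (hξ : Measurable ξ)
    (hC : 0 < C) (hK : 0 < K) (hθ : 0 < θ) {m : ℕ}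
    (h : ∀ v : ℕ → ℕ, ν.real {x | ∀ i < m, ξ (T^[i] x) = v i} ≤
      C * K ^ Nat.count (fun i => v i = 0) m * θ ^ m) :
    ENNReal.ofReal (m * (-Real.log θ - Real.log K * ν.real (ξ ⁻¹' {0})) - Real.log C) ≤
      partitionEntropy ν (itinerary T ξ m) := by
  have h0 : MeasurableSet {x | ξ x = 0} := hξ (measurableSet_singleton 0)
  let visits : Ω → ℝ := fun x => Nat.count (fun i => ξ (T^[i] x) = 0) m
  have hvisits : Integrable visits ν := integrable_count_iterate hT.measurable h0 m
  let g : Ω → ℝ := fun x => (-Real.log C - m * Real.log θ) - Real.log K * visits x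
  have hg : Integrable g ν := (integrable_const _).sub (hvisits.const_mul _)
  have hcell : ∀ x, ν.real (itinerary T ξ m ⁻¹' {itinerary T ξ m x}) ≤ Real.exp (-g x) := by
    intro x
    rw [itinerary_preimage_itinerary]
    refine (h fun i => ξ (T^[i] x)).trans_eq ?_
    rw [← Real.exp_log (show 0 < C * K ^ Nat.count (fun i => ξ (T^[i] x) = 0) m * θ ^ m by
        positivity), Real.log_mul (by positivity) (by positivity),
      Real.log_mul hC.ne' (by positivity), Real.log_pow, Real.log_pow]
    congr 1
    simp only [g, visits]
    ring
  have hvisits_eq : ∫ x, visits x ∂ν = m * ν.real (ξ ⁻¹' {0}) := integral_count_iterate hT h0 m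
  have hint : ∫ x, g x ∂ν =
      m * (-Real.log θ - Real.log K * ν.real (ξ ⁻¹' {0})) - Real.log C := by
    rw [integral_sub (integrable_const _) (hvisits.const_mul _), integral_const_mul,
      hvisits_eq, integral_const, probReal_univ, one_smul]
    ring
  rw [← hint]
  exact ofReal_integral_le_partitionEntropy (measurable_itinerary hT.measurable hξ m) hg hcell

theorem entropyOfPartition_ge (hT : MeasurePreserving T ν ν) (hξ : Measurable ξ)
    (hC : 0 < C) (hK : 0 < K) (hθ : 0 < θ)
    (h : ∀ (m : ℕ) (v : ℕ → ℕ), ν.real {x | ∀ i < m, ξ (T^[i] x) = v i} ≤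
      C * K ^ Nat.count (fun i => v i = 0) m * θ ^ m) :
    ENNReal.ofReal (-Real.log θ - Real.log K * ν.real (ξ ⁻¹' {0})) ≤
      entropyOfPartition T ν ξ := by
  set c := -Real.log θ - Real.log K * ν.real (ξ ⁻¹' {0})
  have hlim : Tendsto (fun m : ℕ => ENNReal.ofReal (c - Real.log C * (m : ℝ)⁻¹)) atTop
      (𝓝 (ENNReal.ofReal c)) := by
    refine ENNReal.tendsto_ofReal ?_
    simpa only [mul_zero, sub_zero] using (tendsto_inv_atTop_nhds_zero_nat (𝕜 := ℝ)).const_mul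
      (Real.log C) |>.const_sub c
  rw [← hlim.liminf_eq]
  refine liminf_le_liminf ?_
  filter_upwards [eventually_gt_atTop 0] with m hm
  have hm' : (0 : ℝ) < m := Nat.cast_pos.2 hm
  rw [ENNReal.le_div_iff_mul_le (by simp [hm.ne']) (by simp)]
  refine le_trans (le_of_eq ?_) (partitionEntropy_itinerary_ge hT hξ hC hK hθ (h m))
  rw [← ENNReal.ofReal_natCast m, ← ENNReal.ofReal_mul' hm'.le]
  congr 1
  field_simp
  ring

end Entropy

/-! ### Bowen sets and cylinders -/

section Covering

variable {G X : Type*} [Group G] [MulAction G X]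

/-- `A` is covered by `k` sets `B` which are `U`-small in the sense that `B B⁻¹ ⊆ U`. Then each
orbit piece `B • x` is contained in `U • y` for every `y ∈ B • x`. -/
def IsCoveredModulo (U : Set G) (k : ℕ) (A : Set G) : Prop :=
  ∃ B : Fin k → Set G, A ⊆ ⋃ j, B j ∧ ∀ j, B j / B j ⊆ U

namespace IsCoveredModulo

variable {U U' A A' : Set G} {k l : ℕ}

theorem of_div_subset (h : A / A ⊆ U) : IsCoveredModulo U 1 A :=
  ⟨fun _ => A, Set.subset_iUnion (fun _ : Fin 1 => A) 0, fun _ => h⟩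

theorem mono_right (h : IsCoveredModulo U k A) (hA : A' ⊆ A) : IsCoveredModulo U k A' :=
  let ⟨B, hB, hBU⟩ := h
  ⟨B, hA.trans hB, hBU⟩

theorem mono_card (h : IsCoveredModulo U k A) (hkl : k ≤ l) : IsCoveredModulo U l A := by
  obtain ⟨B, hB, hBU⟩ := h
  refine ⟨fun j => if hj : (j : ℕ) < k then B ⟨j, hj⟩ else ∅, hB.trans ?_, fun j => ?_⟩
  · refine Set.iUnion_subset fun j => ?_
    refine Set.Subset.trans ?_ (Set.subset_iUnion _ (j.castLE hkl))
    simp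
  · dsimp only
    split_ifs
    · exact hBU _
    · simp

theorem bind (hA : IsCoveredModulo U k A) (hA' : A' ⊆ A)
    (h : ∀ B, B / B ⊆ U → IsCoveredModulo U' l (B ∩ A')) : IsCoveredModulo U' (k * l) A' := by
  obtain ⟨B, hAB, hBU⟩ := hA
  choose D hBD hDU using fun j => h (B j) (hBU j)
  refine ⟨fun i => D (finProdFinEquiv.symm i).1 (finProdFinEquiv.symm i).2, fun g hg => ?_,
    fun i => hDU _ _⟩
  obtain ⟨j, hj⟩ := Set.mem_iUnion.1 (hAB (hA' hg))
  obtain ⟨i, hi⟩ := Set.mem_iUnion.1 (hBD j ⟨hj, hg⟩)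
  exact Set.mem_iUnion.2 ⟨finProdFinEquiv (j, i), by simpa using hi⟩

theorem measure_smul_le [MeasurableSpace X] {ν : Measure X} (hA : IsCoveredModulo U k A) {x : X}
    {β : ℝ≥0∞} (hβ : ∀ g ∈ A, ν ((· • (g • x)) '' U) ≤ β) : ν ((· • x) '' A) ≤ k * β := by
  obtain ⟨B, hAB, hBU⟩ := hA
  have hpiece : ∀ j, ν ((· • x) '' (A ∩ B j)) ≤ β := by
    intro j
    obtain hempty | ⟨g, hgA, hgB⟩ := (A ∩ B j).eq_empty_or_nonempty
    · simp [hempty]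
    · refine (measure_mono ?_).trans (hβ g hgA)
      rintro _ ⟨h, ⟨-, hhB⟩, rfl⟩
      exact ⟨h / g, hBU j (Set.div_mem_div hhB hgB), by simp [smul_smul]⟩
  calc ν ((· • x) '' A) = ν (⋃ j, (· • x) '' (A ∩ B j)) := by
        rw [← Set.image_iUnion, ← Set.inter_iUnion, Set.inter_eq_self_of_subset_left hAB]
    _ ≤ ∑ j, ν ((· • x) '' (A ∩ B j)) := measure_iUnion_fintype_le _ _
    _ ≤ k * β := by simpa using Finset.sum_le_card_nsmul Finset.univ _ β fun j _ => hpiece j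

end IsCoveredModulo

/-- The Bowen set of order `n`: the elements of the group whose conjugates by `1, a, …, aⁿ` all
lie in `U`. The sets `bowenSet a U n • x` play the role of Bowen balls for `x ↦ a • x`. -/
def bowenSet (a : G) (U : Set G) (n : ℕ) : Set G :=
  {g | ∀ k ≤ n, MulAut.conj (a ^ k) g ∈ U}

/-- The labelling `ξ` is `0` exactly outside `Q`, and two points with the same non-zero label
differ by an element of `U`. -/
structure IsLabelling (U : Set G) (Q : Set X) (ξ : X → ℕ) : Prop where
  ne_zero_iff : ∀ x, ξ x ≠ 0 ↔ x ∈ Q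
  exists_smul_eq : ∀ x y, ξ x ≠ 0 → ξ y = ξ x → ∃ u ∈ U, u • x = y

variable {a : G} {U V : Set G} {Q : Set X} {ξ : X → ℕ} {K n : ℕ}

theorem bowenSet_zero (a : G) (U : Set G) : bowenSet a U 0 = U := by
  simp [bowenSet]

theorem mem_bowenSet_succ {g : G} :
    g ∈ bowenSet a U (n + 1) ↔ g ∈ bowenSet a U n ∧ MulAut.conj (a ^ (n + 1)) g ∈ U := by
  simp only [bowenSet, Nat.le_succ_iff, or_imp, forall_and, forall_eq, Set.mem_ofPred_eq]

theorem conj_pow_succ_mem_of_mem_bowenSet {g : G} (hg : g ∈ bowenSet a U n) :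
    MulAut.conj (a ^ (n + 1)) g ∈ MulAut.conj a '' U :=
  ⟨_, hg n le_rfl, by simp [pow_succ', mul_assoc]⟩

theorem isCoveredModulo_bowenSet_succ (hK : IsCoveredModulo U K (MulAut.conj a '' U)) {B : Set G}
    (hB : B / B ⊆ bowenSet a U n) : IsCoveredModulo (bowenSet a U (n + 1)) K B := by
  obtain ⟨D, hUD, hDU⟩ := hK
  obtain rfl | ⟨g₀, hg₀⟩ := B.eq_empty_or_nonempty
  · exact ⟨fun _ => ∅, by simp, by simp⟩
  refine ⟨fun j => {g ∈ B | MulAut.conj (a ^ (n + 1)) (g / g₀) ∈ D j}, fun g hg => ?_, fun j => ?_⟩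
  · obtain ⟨j, hj⟩ := Set.mem_iUnion.1 <|
      hUD (conj_pow_succ_mem_of_mem_bowenSet (hB (Set.div_mem_div hg hg₀)))
    exact Set.mem_iUnion.2 ⟨j, hg, hj⟩
  · rw [Set.div_subset_iff]
    rintro g ⟨hg, hgD⟩ h ⟨hh, hhD⟩
    refine mem_bowenSet_succ.2 ⟨hB (Set.div_mem_div hg hh), ?_⟩
    rw [← div_div_div_cancel_right g h g₀, map_div]
    exact hDU j (Set.div_mem_div hgD hhD)

theorem IsLabelling.mem_of_label_smul_eq (hξ : IsLabelling U Q ξ)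
    (hinj : ∀ x ∈ Q, Set.InjOn (· • x) V) (hUV : U ⊆ V) {x : X} {g : G} (hx : ξ x ≠ 0)
    (hg : g ∈ V) (hgx : ξ (g • x) = ξ x) : g ∈ U := by
  obtain ⟨u, hu, hux⟩ := hξ.exists_smul_eq x (g • x) hx hgx
  rwa [← hinj x ((hξ.ne_zero_iff x).1 hx) (hUV hu) hg hux]

theorem IsLabelling.div_subset_bowenSet_succ (hξ : IsLabelling U Q ξ)
    (hinj : ∀ x ∈ Q, Set.InjOn (· • x) V) (hUV : U ⊆ V) (hconj : MulAut.conj a '' U ⊆ V)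
    {B : Set G} (hB : B / B ⊆ bowenSet a U n) {x : X} {i : ℕ} (hi : i ≠ 0)
    (hBi : ∀ g ∈ B, ξ (a ^ (n + 1) • g • x) = i) : B / B ⊆ bowenSet a U (n + 1) := by
  rw [Set.div_subset_iff]
  intro g hg h hh
  have hgh := hB (Set.div_mem_div hg hh)
  refine mem_bowenSet_succ.2 ⟨hgh, ?_⟩
  refine hξ.mem_of_label_smul_eq hinj hUV (x := a ^ (n + 1) • h • x) (by rwa [hBi h hh])
    (hconj (conj_pow_succ_mem_of_mem_bowenSet hgh)) ?_
  rw [hBi h hh, ← hBi g hg]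
  simp only [smul_smul, MulAut.conj_apply, div_eq_mul_inv]
  group

theorem IsLabelling.isCoveredModulo_cylinder (hξ : IsLabelling U Q ξ)
    (hinj : ∀ x ∈ Q, Set.InjOn (· • x) V) (hUV : U ⊆ V) (hdiv : U / U ⊆ V)
    (hconj : MulAut.conj a '' U ⊆ V) (hK : IsCoveredModulo U K (MulAut.conj a '' U)) {v : ℕ → ℕ}
    (hv : v 0 ≠ 0) (x : X) (m : ℕ) :
    IsCoveredModulo (bowenSet a U m) (K ^ Nat.count (fun i => v i = 0) (m + 1))
      {g ∈ U | ∀ i ≤ m, ξ (a ^ i • g • x) = v i} := by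
  induction m with
  | zero =>
    simp only [zero_add, Nat.count_one, hv, if_false, pow_zero, bowenSet_zero]
    refine .of_div_subset (Set.div_subset_iff.2 ?_)
    rintro g ⟨hgU, hg⟩ h ⟨hhU, hh⟩
    replace hg : ξ (g • x) = v 0 := by simpa using hg 0 le_rfl
    replace hh : ξ (h • x) = v 0 := by simpa using hh 0 le_rfl
    refine hξ.mem_of_label_smul_eq hinj hUV (x := h • x) (by rwa [hh])
      (hdiv (Set.div_mem_div hgU hhU)) ?_
    rw [smul_smul, div_mul_cancel, hg, hh]
  | succ m ih =>
    have hsub : {g ∈ U | ∀ i ≤ m + 1, ξ (a ^ i • g • x) = v i} ⊆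
        {g ∈ U | ∀ i ≤ m, ξ (a ^ i • g • x) = v i} :=
      fun g hg => ⟨hg.1, fun i hi => hg.2 i (by omega)⟩
    rw [Nat.count_succ]
    split_ifs with hm
    · rw [pow_succ]
      exact ih.bind hsub fun B hB =>
        (isCoveredModulo_bowenSet_succ hK hB).mono_right Set.inter_subset_left
    · rw [add_zero, ← mul_one (K ^ _)]
      refine ih.bind hsub fun B hB => .of_div_subset ?_
      exact hξ.div_subset_bowenSet_succ hinj hUV hconj
        ((Set.div_subset_div Set.inter_subset_left Set.inter_subset_left).trans hB) hm
        fun g hg => hg.2.2 _ le_rfl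

variable [MeasurableSpace X] {ν : Measure X}

theorem IsLabelling.measure_cylinder_le_of_ne_zero (hξ : IsLabelling U Q ξ)
    (hinj : ∀ x ∈ Q, Set.InjOn (· • x) V) (hUV : U ⊆ V) (hdiv : U / U ⊆ V)
    (hconj : MulAut.conj a '' U ⊆ V) (hK : IsCoveredModulo U K (MulAut.conj a '' U)) {v : ℕ → ℕ}
    (hv : v 0 ≠ 0) {m : ℕ} {β : ℝ≥0∞} (hβ : ∀ z ∈ Q, ν ((· • z) '' bowenSet a U m) ≤ β) :
    ν {x | ∀ i ≤ m, ξ (a ^ i • x) = v i} ≤ K ^ Nat.count (fun i => v i = 0) (m + 1) * β := by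
  obtain hempty | ⟨x, hx⟩ := {x | ∀ i ≤ m, ξ (a ^ i • x) = v i}.eq_empty_or_nonempty
  · simp [hempty]
  have hx0 : ξ x = v 0 := by simpa using hx 0 (Nat.zero_le m)
  have hcov := hξ.isCoveredModulo_cylinder hinj hUV hdiv hconj hK hv x m
  have hmeas : ν ((· • x) '' {g ∈ U | ∀ i ≤ m, ξ (a ^ i • g • x) = v i}) ≤
      (K ^ Nat.count (fun i => v i = 0) (m + 1) : ℕ) * β := by
    refine hcov.measure_smul_le fun g hg => hβ _ ((hξ.ne_zero_iff _).1 ?_)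
    rwa [show ξ (g • x) = v 0 by simpa using hg.2 0 (Nat.zero_le m)]
  rw [Nat.cast_pow] at hmeas
  refine (measure_mono fun y hy => ?_).trans hmeas
  have hy0 : ξ y = v 0 := by simpa using hy 0 (Nat.zero_le m)
  obtain ⟨u, hu, rfl⟩ := hξ.exists_smul_eq x y (hx0 ▸ hv) (hy0.trans hx0.symm)
  exact ⟨u, ⟨hu, hy⟩, rfl⟩

theorem measureReal_cylinder_succ_le [IsFiniteMeasure ν]
    (hT : MeasurePreserving (fun x : X => a • x) ν ν)
    (hξm : Measurable ξ) (v : ℕ → ℕ) (m : ℕ) :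
    ν.real {x | ∀ i < m + 1, ξ (a ^ i • x) = v i} ≤
      ν.real {x | ∀ i < m, ξ (a ^ i • x) = v (i + 1)} := by
  have hmeas : MeasurableSet {x : X | ∀ i < m, ξ (a ^ i • x) = v (i + 1)} := by
    simp only [← smul_iterate, Set.ofPred_forall]
    exact .iInter fun i => .iInter fun _ =>
      (hξm.comp (hT.measurable.iterate i)) (measurableSet_singleton _)
  rw [← hT.measureReal_preimage hmeas.nullMeasurableSet]
  refine measureReal_mono fun x hx i hi => ?_
  simpa [pow_succ, mul_smul] using hx (i + 1) (by omega)

theorem IsLabelling.measureReal_cylinder_le [IsProbabilityMeasure ν] (hξ : IsLabelling U Q ξ)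
    (hξm : Measurable ξ) (hT : MeasurePreserving (fun x : X => a • x) ν ν)
    (hinj : ∀ x ∈ Q, Set.InjOn (· • x) V) (hUV : U ⊆ V) (hdiv : U / U ⊆ V)
    (hconj : MulAut.conj a '' U ⊆ V) (hK : IsCoveredModulo U K (MulAut.conj a '' U))
    {C θ : ℝ} (hC : 1 ≤ C) (hθ : 0 < θ) (hKθ : 1 ≤ K * θ)
    (hβ : ∀ n, ∀ z ∈ Q, ν ((· • z) '' bowenSet a U n) ≤ ENNReal.ofReal (C * θ ^ (n + 1)))
    (m : ℕ) (v : ℕ → ℕ) : ν.real {x | ∀ i < m, ξ (a ^ i • x) = v i} ≤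
      C * K ^ Nat.count (fun i => v i = 0) m * θ ^ m := by
  induction m generalizing v with
  | zero => simpa using hC
  | succ m ih =>
    by_cases hv : v 0 = 0
    · rw [Nat.count_succ', if_pos hv]
      calc ν.real {x | ∀ i < m + 1, ξ (a ^ i • x) = v i}
          ≤ C * K ^ Nat.count (fun i => v (i + 1) = 0) m * θ ^ m :=
            (measureReal_cylinder_succ_le hT hξm v m).trans (ih fun i => v (i + 1))
        _ ≤ C * K ^ Nat.count (fun i => v (i + 1) = 0) m * θ ^ m * (K * θ) :=
            le_mul_of_one_le_right (by positivity) hKθ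
        _ = _ := by ring
    · have hmeas := hξ.measure_cylinder_le_of_ne_zero hinj hUV hdiv hconj hK hv (hβ m)
      simp only [Nat.lt_add_one_iff]
      refine ENNReal.toReal_le_of_le_ofReal (by positivity) (hmeas.trans_eq ?_)
      rw [mul_assoc, mul_left_comm, ENNReal.ofReal_mul (p := _ ^ _) (by positivity),
        ENNReal.ofReal_pow (Nat.cast_nonneg K), ENNReal.ofReal_natCast]

theorem exists_measurable_labelling_of_cover {X : Type*} [MeasurableSpace X] {Q : Set X}
    (hQ : MeasurableSet Q) {n : ℕ} {O : Fin n → Set X} (hO : ∀ j, MeasurableSet (O j))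
    (hQO : Q ⊆ ⋃ j, O j) :
    ∃ ξ : X → ℕ, Measurable ξ ∧ (∀ x, ξ x ≤ n) ∧ (∀ x, ξ x ≠ 0 ↔ x ∈ Q) ∧
      ∀ x, ξ x ≠ 0 → ∃ j : Fin n, ξ x = j + 1 ∧ x ∈ O j := by
  classical
  let p : X → ℕ → Prop := fun x i => i = 0 ∧ x ∉ Q ∨ ∃ j : Fin n, i = j + 1 ∧ x ∈ Q ∩ O j
  have hp : ∀ x, ∃ i, p x i := fun x => by
    by_cases hx : x ∈ Q
    · obtain ⟨j, hj⟩ := Set.mem_iUnion.1 (hQO hx)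
      exact ⟨j + 1, .inr ⟨j, rfl, hx, hj⟩⟩
    · exact ⟨0, .inl ⟨rfl, hx⟩⟩
  have hpm : ∀ i, MeasurableSet {x | p x i} := fun i =>
    ((MeasurableSet.const _).inter hQ.compl).union <|
      measurableSet_setOfPred.2 <| .exists fun j => .and measurable_const (hQ.inter (hO j)).mem
  refine ⟨fun x => Nat.find (hp x), measurable_find hp hpm, fun x => ?_, fun x => ?_,
    fun x hx => ?_⟩
  · obtain ⟨h, -⟩ | ⟨j, h, -⟩ := Nat.find_spec (hp x) <;> dsimp only <;> omega
  · obtain ⟨h, hx⟩ | ⟨j, h, hx, -⟩ := Nat.find_spec (hp x) <;> simp [h, hx]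
  · obtain ⟨h, -⟩ | ⟨j, h, -, hj⟩ := Nat.find_spec (hp x)
    · exact absurd h hx
    · exact ⟨j, h, hj⟩

theorem exists_isOpen_div_subset {G : Type*} [Group G] [TopologicalSpace G] [IsTopologicalGroup G]
    {U : Set G} (hU : U ∈ 𝓝 1) : ∃ W : Set G, IsOpen W ∧ 1 ∈ W ∧ W / W ⊆ U := by
  obtain ⟨W, hW, hWU⟩ := exists_nhds_split_inv hU
  refine ⟨interior W, isOpen_interior, mem_interior_iff_mem_nhds.2 hW, Set.div_subset_iff.2 ?_⟩
  exact fun g hg h hh => hWU g (interior_subset hg) h (interior_subset hh)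

theorem exists_isLabelling [TopologicalSpace G] [IsTopologicalGroup G] [TopologicalSpace X]
    [OpensMeasurableSpace X] (hop : ∀ x : X, IsOpenMap (· • x : G → X))
    (hQ : IsCompact Q) (hQm : MeasurableSet Q) (hU : U ∈ 𝓝 1) :
    ∃ (ξ : X → ℕ) (R : ℕ), Measurable ξ ∧ (∀ x, ξ x ≤ R) ∧ IsLabelling U Q ξ := by
  obtain ⟨W, hWo, hW1, hWU⟩ := exists_isOpen_div_subset hU
  obtain ⟨t, -, ht⟩ := hQ.elim_nhds_subcover (fun x => (· • x) '' W)
    fun x _ => (hop x _ hWo).mem_nhds ⟨1, hW1, one_smul _ _⟩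
  let e := t.equivFin
  obtain ⟨ξ, hξm, hξR, hξQ, hξO⟩ := exists_measurable_labelling_of_cover hQm
    (O := fun j => (· • (e.symm j : X)) '' W) (fun j => (hop _ _ hWo).measurableSet) fun x hx => by
      obtain ⟨y, hy, hxy⟩ := Set.mem_iUnion₂.1 (ht hx)
      exact Set.mem_iUnion.2 ⟨e ⟨y, hy⟩, by simpa using hxy⟩
  refine ⟨ξ, t.card, hξm, hξR, hξQ, fun x y hx hxy => ?_⟩
  obtain ⟨i, hi, g, hg, rfl⟩ := hξO x hx
  obtain ⟨j, hj, h, hh, rfl⟩ := hξO y (hxy ▸ hx)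
  obtain rfl : i = j := by omega
  exact ⟨h / g, hWU (Set.div_mem_div hh hg), by simp [smul_smul]⟩

end Covering

/-! ### The topology of the coset space -/

namespace CosetSpace

variable {G : Type*} [Group G]

/-- The projection `G → Γ \ G`. -/
def mk (Γ : Subgroup G) : G → CosetSpace Γ :=
  Quotient.mk (QuotientGroup.rightRel Γ)

theorem mk_surjective (Γ : Subgroup G) : Function.Surjective (mk Γ) :=
  Quotient.mk_surjective

theorem mk_eq_mk_iff {Γ : Subgroup G} {g h : G} : mk Γ g = mk Γ h ↔ h * g⁻¹ ∈ Γ :=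
  Quotient.eq.trans QuotientGroup.rightRel_apply

theorem smul_mk (Γ : Subgroup G) (g h : G) : g • mk Γ h = mk Γ (h * g⁻¹) := rfl

variable [TopologicalSpace G] [IsTopologicalGroup G] (Γ : Subgroup G)

theorem isOpenQuotientMap_mk : IsOpenQuotientMap (mk Γ) :=
  ⟨mk_surjective Γ, continuous_quot_mk, isOpenMap_quotient_mk'_mul (Γ := Γ) (T := G)⟩

theorem t2Space [T2Space G] [DiscreteTopology Γ] : T2Space (CosetSpace Γ) := by
  rw [t2Space_iff_of_isOpenQuotientMap (isOpenQuotientMap_mk Γ)]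
  simp only [mk_eq_mk_iff]
  have hΓ : IsClosed (Γ : Set G) := Subgroup.isClosed_of_discrete
  exact hΓ.preimage (show Continuous fun q : G × G => q.2 * q.1⁻¹ by fun_prop)

theorem locallyCompactSpace [LocallyCompactSpace G] : LocallyCompactSpace (CosetSpace Γ) :=
  (isOpenQuotientMap_mk Γ).locallyCompactSpace

theorem secondCountableTopology [SecondCountableTopology G] :
    SecondCountableTopology (CosetSpace Γ) :=
  (isOpenQuotientMap_mk Γ).isQuotientMap.secondCountableTopology (isOpenQuotientMap_mk Γ).isOpenMap

theorem continuous_smul_left (x : CosetSpace Γ) : Continuous (· • x : G → CosetSpace Γ) := by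
  obtain ⟨h, rfl⟩ := mk_surjective Γ x
  simp only [smul_mk]
  exact (isOpenQuotientMap_mk Γ).continuous.comp (by fun_prop)

theorem isOpenMap_smul_left (x : CosetSpace Γ) : IsOpenMap (· • x : G → CosetSpace Γ) := by
  obtain ⟨h, rfl⟩ := mk_surjective Γ x
  exact (isOpenQuotientMap_mk Γ).isOpenMap.comp
    ((Homeomorph.inv G).trans (Homeomorph.mulLeft h)).isOpenMap

instance continuousConstSMul : ContinuousConstSMul G (CosetSpace Γ) where
  continuous_const_smul g := (isOpenQuotientMap_mk Γ).isQuotientMap.continuous_iff.2 <|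
    (isOpenQuotientMap_mk Γ).continuous.comp (show Continuous fun h : G => h * g⁻¹ by fun_prop)

variable [DiscreteTopology Γ]

theorem exists_nhds_forall_injOn_smul (x : CosetSpace Γ) :
    ∃ V ∈ 𝓝 (1 : G), ∃ O ∈ 𝓝 x, ∀ z ∈ O, V.InjOn (· • z) := by
  obtain ⟨W, hW, hWΓ⟩ := nhds_inter_eq_singleton_of_mem_discrete
    (isDiscrete_iff_discreteTopology.mpr ‹_›) (show (1 : G) ∈ (Γ : Set G) from Γ.one_mem)
  obtain ⟨h, rfl⟩ := mk_surjective Γ x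
  have hconj : Tendsto (fun p : G × G × G => p.1 * (p.2.1⁻¹ * p.2.2) * p.1⁻¹)
      (𝓝 h ×ˢ 𝓝 1 ×ˢ 𝓝 1) (𝓝 1) := by
    rw [← nhds_prod_eq, ← nhds_prod_eq]
    exact Continuous.tendsto' (by fun_prop) _ _ (by simp)
  obtain ⟨H, hH, P, hP, hHP⟩ := mem_prod_iff.1 (hconj hW)
  obtain ⟨V, hV, hVP⟩ := mem_prod_self_iff.1 hP
  refine ⟨V, hV, mk Γ '' H, (isOpenQuotientMap_mk Γ).isOpenMap.image_mem_nhds hH, ?_⟩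
  rintro _ ⟨k, hk, rfl⟩ g hg g' hg' hgg'
  have hmemΓ : k * (g⁻¹ * g') * k⁻¹ ∈ Γ := by
    simpa [mul_assoc] using mk_eq_mk_iff.1 hgg'.symm
  have hmemW : k * (g⁻¹ * g') * k⁻¹ ∈ W := @hHP (k, g, g') ⟨hk, hVP ⟨hg, hg'⟩⟩
  exact inv_mul_eq_one.1 (conj_eq_one_iff.1 (hWΓ.subset ⟨hmemW, hmemΓ⟩))

theorem exists_nhds_forall_injOn_smul_of_isCompact {Q : Set (CosetSpace Γ)} (hQ : IsCompact Q) :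
    ∃ V ∈ 𝓝 (1 : G), ∀ z ∈ Q, V.InjOn (· • z) := by
  refine hQ.induction_on (p := fun s => ∃ V ∈ 𝓝 (1 : G), ∀ z ∈ s, V.InjOn (· • z))
    ⟨Set.univ, univ_mem, by simp⟩ ?_ ?_ ?_
  · rintro s t hst ⟨V, hV, hinj⟩
    exact ⟨V, hV, fun z hz => hinj z (hst hz)⟩
  · rintro s t ⟨V, hV, hVs⟩ ⟨W, hW, hWt⟩
    refine ⟨V ∩ W, inter_mem hV hW, fun z hz => hz.elim (fun hzs => ?_) fun hzt => ?_⟩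
    · exact (hVs z hzs).mono Set.inter_subset_left
    · exact (hWt z hzt).mono Set.inter_subset_right
  · intro x _
    obtain ⟨V, hV, O, hO, hinj⟩ := exists_nhds_forall_injOn_smul Γ x
    exact ⟨O, mem_nhdsWithin_of_mem_nhds hO, V, hV, hinj⟩

end CosetSpace

/-! ### Limit points of Cesàro averages -/

section CesaroAverage

variable {X : Type*} [MeasurableSpace X] {μ : Measure X}

theorem cesaroAverage_apply_le {T : X → X} {A : Set X} {B : ℝ≥0∞}
    (h : ∀ l : ℕ, μ.map T^[l] A ≤ B) (k : ℕ) : cesaroAverage T μ k A ≤ B := by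
  rw [cesaroAverage, Measure.smul_apply, Measure.finsetSum_apply, smul_eq_mul]
  calc (k : ℝ≥0∞)⁻¹ * ∑ l ∈ Finset.range k, μ.map T^[l] A
      ≤ (k : ℝ≥0∞)⁻¹ * ∑ _l ∈ Finset.range k, B := by gcongr with l; exact h l
    _ = (k : ℝ≥0∞)⁻¹ * k * B := by
      rw [Finset.sum_const, Finset.card_range, nsmul_eq_mul, mul_assoc]
    _ ≤ B := mul_le_of_le_one_left zero_le (ENNReal.inv_mul_le_one _)

variable [TopologicalSpace X] [BorelSpace X]

theorem integral_cesaroAverage [IsFiniteMeasure μ] {T : X → X} (hT : Continuous T)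
    (f : C_c(X, ℝ)) (k : ℕ) :
    ∫ x, f x ∂(cesaroAverage T μ k) = (k : ℝ)⁻¹ * ∑ l ∈ Finset.range k, ∫ x, f (T^[l] x) ∂μ := by
  have hmap (l : ℕ) : ∫ x, f x ∂(μ.map T^[l]) = ∫ x, f (T^[l] x) ∂μ :=
    integral_map (hT.iterate l).measurable.aemeasurable f.continuous.aestronglyMeasurable
  have hint (l : ℕ) : Integrable f (μ.map T^[l]) :=
    f.continuous.integrable_of_hasCompactSupport f.hasCompactSupport
  rw [cesaroAverage, integral_smul_measure, integral_finsetSum_measure fun l _ => hint l]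
  simp only [ENNReal.toReal_inv, ENNReal.toReal_natCast, smul_eq_mul, hmap]

theorem tendsto_integral_comp_sub_integral_cesaroAverage [IsProbabilityMeasure μ] (T : X ≃ₜ X)
    (f : C_c(X, ℝ)) :
    Tendsto (fun k => ∫ x, f (T x) ∂(cesaroAverage T μ k) - ∫ x, f x ∂(cesaroAverage T μ k))
      atTop (𝓝 0) := by
  let g : C_c(X, ℝ) := ⟨⟨fun x => f (T x), f.continuous.comp T.continuous⟩,
    f.hasCompactSupport.comp_homeomorph T⟩
  obtain ⟨B, hB⟩ : ∃ B, ∀ x, ‖f x‖ ≤ B :=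
    f.hasCompactSupport.exists_bound_of_continuous f.continuous
  have hbound (l : ℕ) : ‖∫ x, f (T^[l] x) ∂μ‖ ≤ B := by
    simpa using norm_integral_le_of_norm_le_const (μ := μ) (ae_of_all μ fun x => hB (T^[l] x))
  have htelescope (k : ℕ) :
      ∫ x, f (T x) ∂(cesaroAverage T μ k) - ∫ x, f x ∂(cesaroAverage T μ k) =
        (k : ℝ)⁻¹ * (∫ x, f (T^[k] x) ∂μ - ∫ x, f (T^[0] x) ∂μ) := by
    have hg (l : ℕ) : ∫ x, g (T^[l] x) ∂μ = ∫ x, f (T^[l + 1] x) ∂μ := by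
      simp only [Function.iterate_succ_apply']
      rfl
    rw [← Finset.sum_range_sub (fun l => ∫ x, f (T^[l] x) ∂μ), Finset.sum_sub_distrib, mul_sub,
      ← integral_cesaroAverage T.continuous, ← Finset.sum_congr rfl fun l _ => hg l,
      ← integral_cesaroAverage T.continuous]
    rfl
  simp only [htelescope]
  refine squeeze_zero_norm (a := fun k : ℕ => (k : ℝ)⁻¹ * (B + B)) (fun k => ?_) ?_
  · rw [norm_mul, norm_inv, Real.norm_natCast]
    gcongr
    exact (norm_sub_le _ _).trans (add_le_add (hbound k) (hbound 0))
  · simpa using (tendsto_inv_atTop_nhds_zero_nat (𝕜 := ℝ)).mul_const (B + B)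

end CesaroAverage

section WeakStar

variable {X : Type*} [TopologicalSpace X]

theorem exists_compactlySupported_between [R1Space X] [LocallyCompactSpace X] {K O : Set X}
    (hK : IsCompact K) (hO : IsOpen O) (hKO : K ⊆ O) :
    ∃ f : C_c(X, ℝ), K.indicator 1 ≤ ⇑f ∧ ⇑f ≤ O.indicator 1 := by
  obtain ⟨f, hf1, hf0, hfc, hf01⟩ := exists_continuous_one_zero_of_isCompact hK hO.isClosed_compl
    (Set.disjoint_compl_right_iff_subset.2 hKO)
  refine ⟨⟨f, hfc⟩, Set.indicator_le' (fun x hx => (hf1 hx).ge) fun x _ => (hf01 x).1,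
    fun x => ?_⟩
  by_cases hx : x ∈ O
  · simpa [hx] using (hf01 x).2
  · simpa [hx] using (hf0 hx).le

namespace IsWeakStarLimitPoint

variable [MeasurableSpace X] {ρ : Measure X} {μs : ℕ → Measure X}

theorem exists_ultrafilter (h : IsWeakStarLimitPoint ρ μs) :
    ∃ F : Ultrafilter ℕ, (F : Filter ℕ) ≤ atTop ∧
      ∀ f : C_c(X, ℝ), Tendsto (fun k => ∫ x, f x ∂(μs k)) F (𝓝 (∫ x, f x ∂ρ)) := by
  obtain ⟨F, hF, h⟩ := mapClusterPt_iff_ultrafilter.1 h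
  exact ⟨F, hF, fun f => tendsto_pi_nhds.1 h f⟩

variable [T2Space X] [LocallyCompactSpace X] [BorelSpace X] [ρ.Regular]

theorem measure_le_of_isOpen (h : IsWeakStarLimitPoint ρ μs) {O : Set X} (hO : IsOpen O)
    {B : ℝ≥0∞} (hB : B ≠ ∞) (hμs : ∀ k, μs k O ≤ B) : ρ O ≤ B := by
  rw [hO.measure_eq_iSup_isCompact]
  refine iSup₂_le fun K hKO => iSup_le fun hK => ?_
  obtain ⟨f, hKf, hfO⟩ := exists_compactlySupported_between hK hO hKO
  have hf0 : 0 ≤ ⇑f := fun x =>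
    (Set.indicator_nonneg (fun _ _ => zero_le_one) x).trans (hKf x)
  have hint : ∀ k, ∫ x, f x ∂(μs k) ≤ B.toReal := fun k =>
    calc ∫ x, f x ∂(μs k) ≤ ∫ x, O.indicator 1 x ∂(μs k) :=
        integral_mono_of_nonneg (ae_of_all _ hf0) ((integrable_indicator_iff hO.measurableSet).2
          (integrableOn_const ((hμs k).trans_lt hB.lt_top).ne)) (ae_of_all _ hfO)
      _ = (μs k).real O := integral_indicator_one hO.measurableSet
      _ ≤ B.toReal := ENNReal.toReal_mono hB (hμs k)
  obtain ⟨F, -, hF⟩ := h.exists_ultrafilter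
  have hreal : ρ.real K ≤ B.toReal :=
    calc ρ.real K = ∫ x, K.indicator 1 x ∂ρ := (integral_indicator_one hK.measurableSet).symm
      _ ≤ ∫ x, f x ∂ρ :=
        integral_mono_of_nonneg (ae_of_all _ (Set.indicator_nonneg fun _ _ => zero_le_one))
          (f.continuous.integrable_of_hasCompactSupport f.hasCompactSupport) (ae_of_all _ hKf)
      _ ≤ B.toReal := le_of_tendsto' (hF f) hint
  exact (ENNReal.toReal_le_toReal hK.measure_lt_top.ne hB).1 hreal

theorem measurePreserving {T : X ≃ₜ X} {μ : Measure X} [IsProbabilityMeasure μ]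
    (h : IsWeakStarLimitPoint ρ (cesaroAverage T μ)) : MeasurePreserving T ρ ρ := by
  have : (ρ.map T).Regular := Measure.Regular.map T
  refine ⟨T.continuous.measurable, Measure.ext_of_integral_eq_on_compactlySupported fun f => ?_⟩
  let g : C_c(X, ℝ) := ⟨⟨fun x => f (T x), f.continuous.comp T.continuous⟩,
    f.hasCompactSupport.comp_homeomorph T⟩
  obtain ⟨F, hF, hlim⟩ := h.exists_ultrafilter
  refine (integral_map T.continuous.measurable.aemeasurable
    f.continuous.aestronglyMeasurable).trans ?_
  exact sub_eq_zero.1 (tendsto_nhds_unique ((hlim g).sub (hlim f))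
    ((tendsto_integral_comp_sub_integral_cesaroAverage T f).mono_left hF))

end IsWeakStarLimitPoint

end WeakStar

/-! ### Measure of Bowen sets -/

section MultiplicityBound

theorem sum_measure_le_of_card_le {X : Type*} [MeasurableSpace X] (μ : Measure X) (P : Finset X)
    {A : X → Set X} (hA : ∀ x, MeasurableSet (A x)) {M : ℕ}
    (hM : ∀ I ⊆ P, ∀ p, (∀ x ∈ I, p ∈ A x) → I.card ≤ M) :
    ∑ x ∈ P, μ (A x) ≤ M * μ Set.univ := by
  classical
  have hcount (p : X) : ∑ x ∈ P, (A x).indicator (1 : X → ℝ≥0∞) p ≤ M := by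
    calc ∑ x ∈ P, (A x).indicator (1 : X → ℝ≥0∞) p = (P.filter fun x => p ∈ A x).card := by
          simp [Set.indicator_apply]
      _ ≤ M := Nat.cast_le.2 <|
          hM _ (Finset.filter_subset _ _) p fun x hx => (Finset.mem_filter.1 hx).2
  calc ∑ x ∈ P, μ (A x) = ∑ x ∈ P, ∫⁻ p, (A x).indicator 1 p ∂μ := by
        simp only [lintegral_indicator_one (hA _)]
    _ = ∫⁻ p, ∑ x ∈ P, (A x).indicator 1 p ∂μ :=
        (lintegral_finsetSum' _ fun x _ => (measurable_one.indicator (hA x)).aemeasurable).symm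
    _ ≤ ∫⁻ _, (M : ℝ≥0∞) ∂μ := lintegral_mono hcount
    _ = M * μ Set.univ := lintegral_const _

variable {G X : Type*} [Group G]

theorem IsCoveredModulo.card_le {U A : Set G} {k : ℕ} (hA : IsCoveredModulo U k A) {I : Finset X}
    {φ : X → G} (hφ : ∀ x ∈ I, φ x ∈ A)
    (hI : (I : Set X).Pairwise fun x y => φ x / φ y ∉ U) : I.card ≤ k := by
  obtain ⟨B, hAB, hB⟩ := hA
  choose j hj using fun x : I => Set.mem_iUnion.1 (hAB (hφ x x.2))
  have hinj : Function.Injective j := fun x y hxy => by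
    by_contra hne
    exact hI x.2 y.2 (Subtype.coe_ne_coe.2 hne) (hB _ (Set.div_mem_div (hj x) (hxy ▸ hj y)))
  simpa using Fintype.card_le_of_injective j hinj

variable [TopologicalSpace G] [IsTopologicalGroup G]

theorem exists_isCoveredModulo_of_isCompact {U A : Set G} (hA : IsCompact A) (hU : U ∈ 𝓝 1) :
    ∃ k, IsCoveredModulo U k A := by
  obtain ⟨W, hWo, hW1, hWU⟩ := exists_isOpen_div_subset hU
  obtain ⟨t, -, ht⟩ := hA.elim_nhds_subcover (fun g => (· * g) '' W) fun g _ =>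
    (isOpenMap_mul_right g _ hWo).mem_nhds ⟨1, hW1, one_mul _⟩
  refine ⟨t.card, fun j => (· * (t.equivFin.symm j : G)) '' W, fun g hg => ?_, fun j => ?_⟩
  · obtain ⟨h, hh, hgh⟩ := Set.mem_iUnion₂.1 (ht hg)
    exact Set.mem_iUnion.2 ⟨t.equivFin ⟨h, hh⟩, by simpa using hgh⟩
  · refine Set.div_subset_iff.2 ?_
    rintro _ ⟨g, hg, rfl⟩ _ ⟨h, hh, rfl⟩
    simpa using hWU (Set.div_mem_div hg hh)

variable [MulAction G X] [TopologicalSpace X]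

theorem exists_finset_separated_cover (hop : ∀ x : X, IsOpenMap (· • x : G → X)) {Q S : Set X}
    (hQ : IsCompact Q) (hSQ : S ⊆ Q) {A : Set G} (hA : A ∈ 𝓝 1) (hA' : A⁻¹ = A) :
    ∃ P : Finset X, ↑P ⊆ S ∧ (P : Set X).Pairwise (fun x y => x ∉ (· • y) '' A) ∧
      S ⊆ ⋃ y ∈ P, (· • y) '' A := by
  classical
  let R : SetRel X X := {p | p.1 ∈ (· • p.2) '' A}
  have : R.IsRefl := ⟨fun x => ⟨1, mem_of_mem_nhds hA, one_smul _ _⟩⟩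
  have : R.IsSymm := ⟨by
    rintro x y ⟨g, hg, hgx⟩
    obtain rfl : g • y = x := hgx
    exact ⟨g⁻¹, Set.mem_inv.1 (by rwa [hA']), inv_smul_smul _ _⟩⟩
  obtain ⟨P, hP⟩ : ∃ P : Set X, Maximal (fun P => P ⊆ S ∧ R.IsSeparated P) P :=
    zorn_subset {P | P ⊆ S ∧ R.IsSeparated P} fun c hc hchain =>
      ⟨⋃₀ c, ⟨Set.sUnion_subset fun P hP => (hc hP).1,
        (Set.pairwise_sUnion hchain.directedOn).2 fun P hP => (hc hP).2⟩,
        fun P hP => Set.subset_sUnion_of_mem hP⟩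
  obtain ⟨W, hWo, hW1, hWA⟩ := exists_isOpen_div_subset hA
  obtain ⟨t, -, ht⟩ := hQ.elim_nhds_subcover (fun x => (· • x) '' W)
    fun x _ => (hop x _ hWo).mem_nhds ⟨1, hW1, one_smul _ _⟩
  have hPfin : P.Finite := by
    choose! i hit hi using fun x (hx : x ∈ P) => Set.mem_iUnion₂.1 (ht (hSQ (hP.1.1 hx)))
    refine Set.Finite.of_injOn hit (fun x hx y hy hxy => ?_) t.finite_toSet
    by_contra hne
    obtain ⟨g, hg, hgx⟩ := hi x hx
    obtain ⟨h, hh, hhy⟩ := hi y hy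
    refine hP.1.2 hx hy hne ⟨g / h, hWA (Set.div_mem_div hg hh), ?_⟩
    rw [← hgx, ← hhy, hxy]
    simp [smul_smul]
  refine ⟨hPfin.toFinset, by simpa using hP.1.1, by rw [hPfin.coe_toFinset]; exact hP.1.2,
    fun x hx => ?_⟩
  obtain ⟨y, hy, hxy⟩ := SetRel.IsCover.of_maximal_isSeparated hP hx
  exact Set.mem_iUnion₂.2 ⟨y, by simpa using hy, hxy⟩

theorem measure_le_of_card_le [MeasurableSpace X] (hop : ∀ x : X, IsOpenMap (· • x : G → X))
    {μ ν : Measure X} {Q S : Set X} (hQ : IsCompact Q) (hSQ : S ⊆ Q) {A D : Set G} (hA : A ∈ 𝓝 1)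
    (hD : ∀ x : X, MeasurableSet ((· • x) '' D)) {β : ℝ≥0∞}
    (hβ : ∀ x ∈ S, μ ((· • x) '' A) ≤ β * ν ((· • x) '' D)) {M : ℕ}
    (hM : ∀ I : Finset X, ↑I ⊆ S → (I : Set X).Pairwise (fun x y => x ∉ (· • y) '' (A ∩ A⁻¹)) →
      ∀ p, (∀ x ∈ I, p ∈ (· • x) '' D) → I.card ≤ M) :
    μ S ≤ β * (M * ν Set.univ) := by
  obtain ⟨P, hPS, hPsep, hPcov⟩ := exists_finset_separated_cover hop hQ hSQ
    (inter_mem hA (inv_mem_nhds_one G hA)) (by rw [Set.inter_inv, inv_inv, Set.inter_comm])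
  calc μ S ≤ μ (⋃ x ∈ P, (· • x) '' (A ∩ A⁻¹)) := measure_mono hPcov
    _ ≤ ∑ x ∈ P, μ ((· • x) '' (A ∩ A⁻¹)) := measure_biUnion_finset_le _ _
    _ ≤ ∑ x ∈ P, β * ν ((· • x) '' D) := Finset.sum_le_sum fun x hx =>
        (measure_mono (Set.image_mono Set.inter_subset_left)).trans (hβ x (hPS hx))
    _ ≤ β * (M * ν Set.univ) := by
        rw [← Finset.mul_sum]
        gcongr
        refine sum_measure_le_of_card_le ν P hD fun I hI p hp => ?_
        exact hM I ((Finset.coe_subset.2 hI).trans hPS) (hPsep.mono (Finset.coe_subset.2 hI)) p hp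

end MultiplicityBound

section ExpandingBoxes

/-- The sets `F s r` behave under conjugation by `a` like boxes around `1` with side `s` in the
directions which are not expanded and side `r` in the expanded ones, the expansion being by the
factor `q⁻¹`. -/
structure ExpandingBoxes {G : Type*} [Group G] [TopologicalSpace G] (a : G) (q : ℝ)
    (F : ℝ → ℝ → Set G) : Prop where
  mono : ∀ s, Monotone (F s)
  mem_nhds : ∀ {s r}, 0 < s → 0 < r → F s r ∈ 𝓝 1
  conj_mem : ∀ V ∈ 𝓝 (1 : G), ∃ s₁ > 0, ∀ s, 0 < s → s ≤ s₁ → ∀ l : ℕ, ∀ f ∈ F s (s * q ^ l),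
    MulAut.conj (a ^ l) f ∈ V
  mem_of_conj_mem : ∀ s > 0, ∃ c > 0, ∃ V ∈ 𝓝 (1 : G), ∀ h ∈ V, ∀ k : ℕ,
    MulAut.conj (a ^ k) h ∈ V → h ∈ F s (c * q ^ k)

/-- The analogue for the sets `F s r` of the local dimension of `μ` in the expanded directions:
shrinking the expanded side of a box by the factor `δ` shrinks its measure by the factor `δ ^ κ`,
up to a constant and up to replacing `μ` by another finite measure. -/
def HasBoxDimension {G X : Type*} [Group G] [MulAction G X] [TopologicalSpace X]
    [MeasurableSpace X] (F : ℝ → ℝ → Set G) (μ : Measure X) (κ : ℝ) : Prop :=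
  IsCompact μ.support ∧
    ∃ s₀ : ℝ, 0 < s₀ ∧ ∃ lam : Measure X, IsFiniteMeasure lam ∧ ∃ C : ℝ≥0,
      ∀ (s s' δ : ℝ) (x : X), 0 < s' → s' ≤ s → s < s₀ → 0 < δ → δ < 1 → x ∈ μ.support →
        μ ((· • x) '' F s (δ * s')) ≤ C * ENNReal.ofReal (δ ^ κ) * lam ((· • x) '' F s s')

variable {G X : Type*} [Group G] [MulAction G X] {a : G}

theorem conj_inv_mul_eq_div_of_smul_eq {V : Set G} {f f' d d' : G} {x x' z : X} {l : ℕ}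
    (hinj : V.InjOn (· • z)) (hV : MulAut.conj (a ^ l) f * d ∈ V)
    (hV' : MulAut.conj (a ^ l) f' * d' ∈ V) (hd : d • z = a ^ l • x) (hd' : d' • z = a ^ l • x')
    (h : f • x = f' • x') : MulAut.conj (a ^ l) (f⁻¹ * f') = d / d' := by
  have heq : MulAut.conj (a ^ l) f * d = MulAut.conj (a ^ l) f' * d' := by
    refine hinj hV hV' ?_
    simp only [mul_smul, hd, hd', MulAut.conj_apply, inv_smul_smul, h]
  rw [map_mul, map_inv, eq_div_iff_mul_eq', mul_assoc, ← heq, inv_mul_cancel_left]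

variable [TopologicalSpace G] [IsTopologicalGroup G] [LocallyCompactSpace G]
  {F : ℝ → ℝ → Set G} {q : ℝ} {Q : Set X} {V₀ : Set G}

/-- Suppose that `a ^ l • x` and `a ^ l • y` lie in a Bowen set of order `n` and that the boxes at
`x` and `y` with expanded side `s * q ^ l` meet at `p = f • x = f' • y`. Then `f⁻¹ * f'` stays small
for `l + n` steps, hence lies in the box with expanded side `c * q ^ (l + n)`. -/
theorem ExpandingBoxes.exists_card_le (hF : ExpandingBoxes a q F) (hq : 0 < q) (hq1 : q ≤ 1)
    (hV₀ : V₀ ∈ 𝓝 1) (hinj : ∀ z ∈ Q, V₀.InjOn (· • z)) :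
    ∃ s₁ > 0, ∀ s, 0 < s → s ≤ s₁ → ∃ c > 0, ∃ V ∈ 𝓝 (1 : G), ∃ M : ℕ, ∀ U ⊆ V, ∀ n l : ℕ,
      ∀ z ∈ Q, ∀ I : Finset X, (∀ x ∈ I, a ^ l • x ∈ (· • z) '' bowenSet a U n) →
      (I : Set X).Pairwise (fun x y =>
        x ∉ (· • y) '' (F s (c * q ^ (l + n)) ∩ (F s (c * q ^ (l + n)))⁻¹)) →
      ∀ p, (∀ x ∈ I, p ∈ (· • x) '' F s (s * q ^ l)) → I.card ≤ M := by
  obtain ⟨V₁, hV₁, hV₁V₀⟩ := exists_nhds_one_split hV₀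
  obtain ⟨K, hK, hK1⟩ := exists_compact_mem_nhds (1 : G)
  obtain ⟨s₁, hs₁, hsmall⟩ := hF.conj_mem (V₁ ∩ K) (inter_mem hV₁ hK1)
  refine ⟨s₁, hs₁, fun s hs hss₁ => ?_⟩
  obtain ⟨c, hc, E, hE, hbox⟩ := hF.mem_of_conj_mem s hs
  obtain ⟨V₂, hV₂, hV₂E⟩ := exists_nhds_split_inv hE
  obtain ⟨M, hM⟩ := exists_isCoveredModulo_of_isCompact hK.inv
    (inter_mem hE (inv_mem_nhds_one G hE))
  refine ⟨c, hc, V₁ ∩ V₂, inter_mem hV₁ hV₂, M, fun U hU n l z hz I hI hsep p hp => ?_⟩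
  choose! d hd hdx using hI
  choose! f hf hfp using hp
  have hd₁ (x) (hx : x ∈ I) : d x ∈ V₁ := by simpa using (hU (hd x hx 0 (Nat.zero_le n))).1
  have hconj (x) (hx : x ∈ I) (y) (hy : y ∈ I) :
      MulAut.conj (a ^ (l + n)) ((f x)⁻¹ * f y) ∈ E := by
    rw [add_comm, pow_add, map_mul MulAut.conj, MulAut.mul_apply,
      conj_inv_mul_eq_div_of_smul_eq (hinj z hz)
        (hV₁V₀ _ (hsmall s hs hss₁ l _ (hf x hx)).1 _ (hd₁ x hx))
        (hV₁V₀ _ (hsmall s hs hss₁ l _ (hf y hy)).1 _ (hd₁ y hy)) (hdx x hx) (hdx y hy)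
        ((hfp x hx).trans (hfp y hy).symm), map_div]
    exact hV₂E _ (hU (hd x hx n le_rfl)).2 _ (hU (hd y hy n le_rfl)).2
  have hfK (x) (hx : x ∈ I) : f x ∈ K := by
    have hmem : f x ∈ F s (s * q ^ 0) :=
      hF.mono s (mul_le_mul_of_nonneg_left (pow_le_pow_of_le_one hq.le hq1 l.zero_le) hs.le)
        (hf x hx)
    simpa using (hsmall s hs hss₁ 0 _ hmem).2
  refine hM.card_le (φ := fun x => (f x)⁻¹) (fun x hx => Set.inv_mem_inv.2 (hfK x hx)) ?_
  rintro x hx y hy hne ⟨hxyE, hyxE⟩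
  rw [Set.mem_inv] at hyxE
  simp only [div_inv_eq_mul, mul_inv_rev, inv_inv] at hxyE hyxE
  refine hsep hx hy hne ⟨(f x)⁻¹ * f y, ⟨hbox _ hxyE _ (hconj x hx y hy), ?_⟩, ?_⟩
  · simpa using hbox _ hyxE _ (hconj y hy x hx)
  · simpa only [mul_smul, inv_smul_eq_iff] using (hfp y hy).trans (hfp x hx).symm

theorem HasBoxDimension.exists_measure_bowenSet_le [TopologicalSpace X]
    [HereditarilyLindelofSpace X] [MeasurableSpace X] {μ : Measure X} [IsProbabilityMeasure μ]
    {κ : ℝ} (hμ : HasBoxDimension F μ κ) (hκ : 0 ≤ κ) (hF : ExpandingBoxes a q F) (hq : 0 < q)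
    (hq1 : q ≤ 1) (hFm : ∀ s r (x : X), MeasurableSet ((· • x) '' F s r))
    (hop : ∀ x : X, IsOpenMap (· • x : G → X)) (hV₀ : V₀ ∈ 𝓝 1)
    (hinj : ∀ z ∈ Q, V₀.InjOn (· • z)) :
    ∃ V ∈ 𝓝 (1 : G), ∃ C : ℝ, ∀ U ⊆ V, ∀ n l : ℕ, ∀ z ∈ Q,
      μ ((a ^ l • ·) ⁻¹' ((· • z) '' bowenSet a U n)) ≤ ENNReal.ofReal (C * (q ^ κ) ^ n) := by
  obtain ⟨hsupp, s₀, hs₀, lam, hlam, C₀, hμ⟩ := hμ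
  obtain ⟨s₁, hs₁, hcard⟩ := hF.exists_card_le hq hq1 hV₀ hinj
  obtain ⟨s, hs, hss⟩ := exists_between (lt_min hs₁ hs₀)
  obtain ⟨hss₁, hss₀⟩ := lt_min_iff.1 hss
  obtain ⟨c, hc, V, hV, M, hM⟩ := hcard s hs hss₁.le
  set B := max 1 (C₀ * (M * lam.real Set.univ))
  refine ⟨V, hV, (c / s) ^ κ * B, fun U hU n l z hz => ?_⟩
  set δ := c / s * q ^ n with hδ
  have hδ0 : 0 < δ := by positivity
  have hδκ : (c / s) ^ κ * B * (q ^ κ) ^ n = δ ^ κ * B := by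
    rw [hδ, Real.mul_rpow (by positivity) (by positivity), Real.rpow_pow_comm hq.le]
    ring
  rw [hδκ]
  obtain hδ1 | hδ1 := le_or_gt 1 δ
  · exact prob_le_one.trans (ENNReal.one_le_ofReal.2
      (one_le_mul_of_one_le_of_one_le (Real.one_le_rpow hδ1 hκ) (le_max_left _ _)))
  have hside : c * q ^ (l + n) = δ * (s * q ^ l) := by
    rw [hδ, pow_add]
    field_simp
  set S := μ.support ∩ (a ^ l • ·) ⁻¹' ((· • z) '' bowenSet a U n)
  have hS : μ S ≤ C₀ * ENNReal.ofReal (δ ^ κ) * (M * lam Set.univ) := by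
    refine measure_le_of_card_le hop hsupp Set.inter_subset_left
      (hF.mem_nhds hs (r := c * q ^ (l + n)) (by positivity)) (hFm s (s * q ^ l)) (fun x hx => ?_)
      fun I hI => hM U hU n l z hz I fun x hx => (hI hx).2
    rw [hside]
    exact hμ s _ δ x (by positivity) (mul_le_of_le_one_right hs.le (pow_le_one₀ hq.le hq1)) hss₀
      hδ0 hδ1 hx.1
  calc μ ((a ^ l • ·) ⁻¹' ((· • z) '' bowenSet a U n)) ≤ μ S + μ μ.supportᶜ :=
        (measure_mono fun x hx => (em (x ∈ μ.support)).imp_left (⟨·, hx⟩)).trans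
          (measure_union_le _ _)
    _ ≤ C₀ * ENNReal.ofReal (δ ^ κ) * (M * lam Set.univ) := by
        rwa [Measure.measure_compl_support, add_zero]
    _ = ENNReal.ofReal (δ ^ κ * (C₀ * (M * lam.real Set.univ))) := by
        rw [ENNReal.ofReal_mul (by positivity), ENNReal.ofReal_mul (by positivity),
          ENNReal.ofReal_mul (by positivity), ENNReal.ofReal_coe_nnreal, ENNReal.ofReal_natCast,
          Measure.real, ENNReal.ofReal_toReal (measure_ne_top _ _)]
        ring
    _ ≤ ENNReal.ofReal (δ ^ κ * B) := by
        gcongr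
        exact le_max_right _ _

end ExpandingBoxes

/-! ### Conjugation of small balls in a linear group -/

theorem exists_finset_forall_norm_sub_smul_lt (E : Type*) [NormedAddCommGroup E]
    [NormedSpace ℝ E] [ProperSpace E] (c : ℝ) {η : ℝ} (hη : 0 < η) :
    ∃ t : Finset E, ∀ r > 0, ∀ v : E, ‖v‖ ≤ r * c → ∃ m ∈ t, ‖v - r • m‖ < r * η := by
  obtain ⟨t, -, ht⟩ := (isCompact_closedBall (0 : E) c).elim_nhds_subcover
    (fun m => Metric.ball m η) fun m _ => Metric.ball_mem_nhds m hη
  refine ⟨t, fun r hr v hv => ?_⟩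
  have hmem : r⁻¹ • v ∈ Metric.closedBall (0 : E) c := by
    rwa [mem_closedBall_zero_iff, norm_smul, norm_inv, Real.norm_of_nonneg hr.le,
      inv_mul_le_iff₀ hr]
  obtain ⟨m, hm, hvm⟩ := Set.mem_iUnion₂.1 (ht hmem)
  refine ⟨m, hm, ?_⟩
  calc ‖v - r • m‖ = ‖r • (r⁻¹ • v - m)‖ := by rw [smul_sub, smul_inv_smul₀ hr.ne']
    _ = r * ‖r⁻¹ • v - m‖ := by rw [norm_smul, Real.norm_of_nonneg hr.le]
    _ < r * η := by gcongr; rwa [Metric.mem_ball, dist_eq_norm] at hvm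

section ConjugateCover

variable {A G : Type*} [NormedRing A] [Group G] (f : G →* A)

theorem norm_map_conj_sub_one_le (a g : G) :
    ‖f (MulAut.conj a g) - 1‖ ≤ ‖f g - 1‖ * (‖f a‖ * ‖f a⁻¹‖) := by
  have hconj : f (MulAut.conj a g) - 1 = f a * (f g - 1) * f a⁻¹ := by
    rw [mul_sub, sub_mul, mul_one, ← map_mul, ← map_mul, ← map_mul, mul_inv_cancel, map_one,
      MulAut.conj_apply]
  calc ‖f (MulAut.conj a g) - 1‖ ≤ ‖f a‖ * ‖f g - 1‖ * ‖f a⁻¹‖ := by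
        rw [hconj]
        exact norm_mul₃_le
    _ = ‖f g - 1‖ * (‖f a‖ * ‖f a⁻¹‖) := by ring

theorem norm_map_inv_le {g : G} (hg : ‖f g - 1‖ ≤ 1 / 2) : ‖f g⁻¹‖ ≤ 2 * ‖(1 : A)‖ := by
  have hinv : f g⁻¹ = 1 - (f g - 1) * f g⁻¹ := by
    rw [sub_mul, ← map_mul, mul_inv_cancel, map_one, one_mul, sub_sub_cancel]
  have hle : ‖f g⁻¹‖ ≤ ‖(1 : A)‖ + 1 / 2 * ‖f g⁻¹‖ :=
    calc ‖f g⁻¹‖ ≤ ‖(1 : A)‖ + ‖(f g - 1) * f g⁻¹‖ := by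
          conv_lhs => rw [hinv]
          exact norm_sub_le _ _
      _ ≤ ‖(1 : A)‖ + 1 / 2 * ‖f g⁻¹‖ := by grw [norm_mul_le, hg]
  linarith

theorem norm_map_div_sub_one_le (g : G) {h : G} (hh : ‖f h - 1‖ ≤ 1 / 2) :
    ‖f (g / h) - 1‖ ≤ ‖f g - f h‖ * (2 * ‖(1 : A)‖) := by
  have hdiv : f (g / h) - 1 = (f g - f h) * f h⁻¹ := by
    rw [sub_mul, ← map_mul, ← map_mul, mul_inv_cancel, map_one, div_eq_mul_inv]
  grw [hdiv, norm_mul_le, norm_map_inv_le f hh]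

variable [NormedAlgebra ℝ A]

theorem exists_isCoveredModulo_conj_ball [ProperSpace A] (a : G) :
    ∃ K : ℕ, ∃ r₀ > 0, ∀ r > 0, r ≤ r₀ →
      IsCoveredModulo (f ⁻¹' Metric.ball 1 r) K (MulAut.conj a '' (f ⁻¹' Metric.ball 1 r)) := by
  set c := ‖f a‖ * ‖f a⁻¹‖
  set e := ‖(1 : A)‖
  obtain ⟨t, ht⟩ := exists_finset_forall_norm_sub_smul_lt A c (η := 1 / (4 * (e + 1)))
    (by positivity)
  refine ⟨t.card, 1 / (2 * (c + 1)), by positivity, fun r hr hr₀ => ?_⟩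
  refine ⟨fun j => {g | ‖f g - 1‖ ≤ 1 / 2 ∧
    ‖f g - 1 - r • (t.equivFin.symm j : A)‖ < r * (1 / (4 * (e + 1)))}, ?_, ?_⟩
  · rintro _ ⟨g, hg, rfl⟩
    have hconj : ‖f (MulAut.conj a g) - 1‖ ≤ r * c := by
      grw [norm_map_conj_sub_one_le, (mem_ball_iff_norm.1 hg).le]
    have hrc : r * c ≤ 1 / 2 := by
      rw [le_div_iff₀ (by positivity)] at hr₀
      linarith
    obtain ⟨m, hm, hgm⟩ := ht r hr _ hconj
    exact Set.mem_iUnion.2 ⟨t.equivFin ⟨m, hm⟩, hconj.trans hrc, by rwa [Equiv.symm_apply_apply]⟩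
  · intro j
    rw [Set.div_subset_iff]
    rintro g hg h hh
    have hgh : ‖f g - f h‖ ≤ r * (1 / (2 * (e + 1))) := by
      set m : A := r • (t.equivFin.symm j : A)
      calc ‖f g - f h‖ = ‖(f g - 1 - m) - (f h - 1 - m)‖ := by congr 1; abel
        _ ≤ r * (1 / (4 * (e + 1))) + r * (1 / (4 * (e + 1))) :=
          (norm_sub_le _ _).trans (add_le_add hg.2.le hh.2.le)
        _ = r * (1 / (2 * (e + 1))) := by field_simp; norm_num
    refine mem_ball_iff_norm.2 ?_
    calc ‖f (g / h) - 1‖ ≤ r * (1 / (2 * (e + 1))) * (2 * e) :=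
          (norm_map_div_sub_one_le f g hh.1).trans (by gcongr)
      _ = r * (e / (e + 1)) := by field_simp
      _ < r := mul_lt_of_lt_one_right hr ((div_lt_one (by positivity)).2 (lt_add_one e))

theorem exists_isOpen_isCoveredModulo_conj [ProperSpace A] [TopologicalSpace G] {f : G →* A}
    (hf : IsInducing f) (a : G) :
    ∃ K : ℕ, ∀ V ∈ 𝓝 (1 : G), ∃ U : Set G, IsOpen U ∧ 1 ∈ U ∧ U ⊆ V ∧
      IsCoveredModulo U K (MulAut.conj a '' U) := by
  obtain ⟨K, r₀, hr₀, hK⟩ := exists_isCoveredModulo_conj_ball f a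
  refine ⟨K, fun V hV => ?_⟩
  rw [hf.nhds_eq_comap, map_one] at hV
  obtain ⟨r, hr, hrV⟩ := (Metric.nhds_basis_ball.comap f).mem_iff.1 hV
  refine ⟨f ⁻¹' Metric.ball 1 (min r r₀), Metric.isOpen_ball.preimage hf.continuous, ?_, ?_,
    hK _ (lt_min hr hr₀) (min_le_right _ _)⟩
  · simpa using And.intro hr hr₀
  · exact (Set.preimage_mono (Metric.ball_subset_ball (min_le_left _ _))).trans hrV

end ConjugateCover

/-! ### The closed subgroup theorem -/

section ExpDerivative

variable {A : Type*} [NormedRing A] [NormedAlgebra ℝ A] [CompleteSpace A]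

/-- The powers `exp (u n) ^ ⌊s / ‖u n‖⌋` stay in `S` and converge to `exp (s • Y)`. -/
theorem exp_smul_mem_of_tendsto {S : Submonoid A} (hS : IsClosed (S : Set A)) {u : ℕ → A} {Y : A}
    (hu : Tendsto u atTop (𝓝 0)) (hu₀ : ∀ n, u n ≠ 0) (huS : ∀ n, NormedSpace.exp (u n) ∈ S)
    (hY : Tendsto (fun n => ‖u n‖⁻¹ • u n) atTop (𝓝 Y)) {s : ℝ} (hs : 0 ≤ s) :
    NormedSpace.exp (s • Y) ∈ S := by
  let _ : NormedAlgebra ℚ A := NormedAlgebra.restrictScalars ℚ ℝ A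
  have hinv : Tendsto (fun n => ‖u n‖⁻¹) atTop atTop :=
    tendsto_inv_nhdsGT_zero.comp <| tendsto_nhdsWithin_iff.2
      ⟨by simpa using hu.norm, Eventually.of_forall fun n => norm_pos_iff.2 (hu₀ n)⟩
  have hfloor := (tendsto_nat_floor_mul_div_atTop hs).comp hinv
  have hlim : Tendsto (fun n => ⌊s * ‖u n‖⁻¹⌋₊ • u n) atTop (𝓝 (s • Y)) := by
    refine (hfloor.smul hY).congr fun n => ?_
    rw [Function.comp_apply, smul_smul,
      div_mul_cancel₀ _ (inv_ne_zero (norm_ne_zero_iff.2 (hu₀ n))), Nat.cast_smul_eq_nsmul]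
  refine hS.mem_of_tendsto ((NormedSpace.exp_continuous.tendsto _).comp hlim)
    (Eventually.of_forall fun n => ?_)
  rw [Function.comp_apply, NormedSpace.exp_nsmul]
  exact S.pow_mem (huS n) _

variable {E F : Type*} [NormedAddCommGroup E] [NormedSpace ℝ E] [NormedAddCommGroup F]
  [NormedSpace ℝ F]

theorem hasStrictFDerivAt_exp_clm (P : E →L[ℝ] A) :
    HasStrictFDerivAt (fun x => NormedSpace.exp (P x)) P 0 :=
  HasStrictFDerivAt.comp (0 : E) (by rw [map_zero]; exact hasStrictFDerivAt_exp_zero (𝕂 := ℝ))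
    P.hasStrictFDerivAt

theorem hasStrictFDerivAt_mul_exp_clm {ψ : E → A} {D : E →L[ℝ] A} (hψ : HasStrictFDerivAt ψ D 0)
    (hψ₀ : ψ 0 = 1) (P : F →L[ℝ] A) :
    HasStrictFDerivAt (fun p : E × F => ψ p.1 * NormedSpace.exp (P p.2)) (D.coprod P) 0 := by
  refine (HasStrictFDerivAt.mul'
    (HasStrictFDerivAt.comp (f := Prod.fst) (0 : E × F) hψ hasStrictFDerivAt_fst)
    (HasStrictFDerivAt.comp (f := Prod.snd) (0 : E × F) (hasStrictFDerivAt_exp_clm P)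
      hasStrictFDerivAt_snd)).congr_fderiv (ContinuousLinearMap.ext fun x => ?_)
  simp [hψ₀, add_comm]

end ExpDerivative

section ClosedSubgroup

variable {A G : Type*} [NormedRing A] [NormedAlgebra ℝ A] [FiniteDimensional ℝ A] [Group G]
  [TopologicalSpace G] {f : G →* A} (hf : IsClosedEmbedding f) {𝔤 : Submodule ℝ A}
  (h𝔤 : ∀ X, (∀ s : ℝ, NormedSpace.exp (s • X) ∈ MonoidHom.mrange f) → X ∈ 𝔤)
include hf h𝔤

theorem mem_of_tendsto_of_exp_mem_mrange {u : ℕ → A} {Y : A} (hu : Tendsto u atTop (𝓝 0))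
    (hu₀ : ∀ n, u n ≠ 0) (huf : ∀ n, NormedSpace.exp (u n) ∈ MonoidHom.mrange f)
    (hY : Tendsto (fun n => ‖u n‖⁻¹ • u n) atTop (𝓝 Y)) : Y ∈ 𝔤 := by
  have : CompleteSpace A := FiniteDimensional.complete ℝ A
  let _ : NormedAlgebra ℚ A := NormedAlgebra.restrictScalars ℚ ℝ A
  have hnonneg : ∀ s : ℝ, 0 ≤ s → NormedSpace.exp (s • Y) ∈ MonoidHom.mrange f :=
    fun s => exp_smul_mem_of_tendsto hf.isClosed_range hu hu₀ huf hY
  refine h𝔤 Y fun s => ?_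
  obtain hs | hs := le_total 0 s
  · exact hnonneg s hs
  · obtain ⟨g, hg⟩ := hnonneg (-s) (neg_nonneg.2 hs)
    refine ⟨g⁻¹, ?_⟩
    have hinv : NormedSpace.exp (-s • Y) * NormedSpace.exp (s • Y) = 1 := by
      rw [← NormedSpace.exp_add_of_commute ((Commute.refl Y).smul_left _ |>.smul_right _),
        ← add_smul, neg_add_cancel, zero_smul, NormedSpace.exp_zero]
    refine left_inv_eq_right_inv ?_ hinv
    rw [← hg, ← map_mul, inv_mul_cancel, map_one]

theorem eventually_eq_zero_of_exp_mem_mrange {𝔪 : Submodule ℝ A} (h𝔪 : Disjoint 𝔤 𝔪) :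
    ∀ᶠ m : 𝔪 in 𝓝 0, NormedSpace.exp (m : A) ∈ MonoidHom.mrange f → m = 0 := by
  by_contra hcon
  have hfreq : ∃ᶠ m : 𝔪 in 𝓝 0, NormedSpace.exp (m : A) ∈ MonoidHom.mrange f ∧ m ≠ 0 :=
    (Filter.not_eventually.1 hcon).mono fun m hm => Classical.not_imp.1 hm
  obtain ⟨u, hu, huf⟩ := exists_seq_forall_of_frequently hfreq
  have hsphere : ∀ n, ‖u n‖⁻¹ • u n ∈ Metric.sphere (0 : 𝔪) 1 := fun n => by
    rw [mem_sphere_zero_iff_norm, norm_smul, norm_inv, norm_norm,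
      inv_mul_cancel₀ (norm_ne_zero_iff.2 (huf n).2)]
  obtain ⟨Y, hY, φ, hφ, hlim⟩ := (isCompact_sphere (0 : 𝔪) 1).tendsto_subseq hsphere
  have hYG : (Y : A) ∈ 𝔤 :=
    mem_of_tendsto_of_exp_mem_mrange hf h𝔤 (u := fun n => u (φ n))
      ((continuous_subtype_val.tendsto _).comp (hu.comp hφ.tendsto_atTop))
      (fun n => by simpa using (huf (φ n)).2) (fun n => (huf (φ n)).1)
      ((continuous_subtype_val.tendsto _).comp hlim)
  have hY₀ : Y = 0 := Subtype.ext (Submodule.disjoint_def.1 h𝔪 _ hYG Y.2)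
  simp [hY₀] at hY

/-- Multiplying `φ` by the exponentials of a complement `𝔪` of `𝔤` yields a local submersion onto
the algebra, and near `1` the factor `exp m` is trivial on the range of `f`. -/
theorem image_mem_nhds_one_of_hasStrictFDerivAt {E : Type*} [NormedAddCommGroup E]
    [NormedSpace ℝ E] [CompleteSpace E] {φ : E → G} {D : E →L[ℝ] A}
    (hφ : HasStrictFDerivAt (fun x => f (φ x)) D 0) (hφ₀ : φ 0 = 1)
    (hD : 𝔤 ≤ LinearMap.range (D : E →ₗ[ℝ] A)) {B : Set E} (hB : B ∈ 𝓝 0) :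
    φ '' B ∈ 𝓝 1 := by
  have : CompleteSpace A := FiniteDimensional.complete ℝ A
  obtain ⟨𝔪, h𝔪⟩ := Submodule.exists_isCompl 𝔤
  let Ψ : E × 𝔪 → A := fun p => f (φ p.1) * NormedSpace.exp (p.2 : A)
  have hsurj : LinearMap.range (D.coprod 𝔪.subtypeL : E × 𝔪 →ₗ[ℝ] A) = ⊤ := by
    rw [ContinuousLinearMap.coe_coprod, LinearMap.range_coprod, eq_top_iff, ← h𝔪.sup_eq_top]
    exact sup_le_sup hD (Submodule.range_subtype 𝔪).ge
  have hmap : map Ψ (𝓝 0) = 𝓝 (f 1) := by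
    have hΨ : HasStrictFDerivAt Ψ (D.coprod 𝔪.subtypeL) 0 :=
      hasStrictFDerivAt_mul_exp_clm hφ (by rw [hφ₀, map_one]) 𝔪.subtypeL
    rw [hΨ.map_nhds_eq_of_surj hsurj]
    simp [Ψ, hφ₀]
  have himage :
      Ψ '' (B ×ˢ {m : 𝔪 | NormedSpace.exp (m : A) ∈ MonoidHom.mrange f → m = 0}) ∈ 𝓝 (f 1) := by
    rw [← hmap]
    exact image_mem_map
      (prod_mem_nhds hB (eventually_eq_zero_of_exp_mem_mrange hf h𝔤 h𝔪.disjoint))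
  filter_upwards [hf.continuous.continuousAt.preimage_mem_nhds himage] with g hg
  obtain ⟨⟨x, m⟩, ⟨hx, hm⟩, hxm⟩ := hg
  have hexpm : NormedSpace.exp (m : A) = f ((φ x)⁻¹ * g) := by
    rw [map_mul, ← hxm, ← mul_assoc, ← map_mul, inv_mul_cancel, map_one, one_mul]
  obtain rfl : m = 0 := hm ⟨_, hexpm.symm⟩
  refine ⟨x, hx, hf.injective ?_⟩
  rw [← hxm]
  simp [Ψ]

theorem image_mem_nhds_one_of_eq_exp_mul_exp_mul_exp {E₁ E₂ E₃ : Type*}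
    [NormedAddCommGroup E₁] [NormedSpace ℝ E₁] [CompleteSpace E₁]
    [NormedAddCommGroup E₂] [NormedSpace ℝ E₂] [CompleteSpace E₂]
    [NormedAddCommGroup E₃] [NormedSpace ℝ E₃] [CompleteSpace E₃]
    (L₁ : E₁ →L[ℝ] A) (L₂ : E₂ →L[ℝ] A) (L₃ : E₃ →L[ℝ] A)
    (hL : 𝔤 ≤ LinearMap.range (L₁ : E₁ →ₗ[ℝ] A) ⊔ LinearMap.range (L₂ : E₂ →ₗ[ℝ] A) ⊔
      LinearMap.range (L₃ : E₃ →ₗ[ℝ] A)) {φ : (E₁ × E₂) × E₃ → G}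
    (hφ : ∀ p, f (φ p) = NormedSpace.exp (L₁ p.1.1) * NormedSpace.exp (L₂ p.1.2) *
      NormedSpace.exp (L₃ p.2)) {B : Set ((E₁ × E₂) × E₃)} (hB : B ∈ 𝓝 0) : φ '' B ∈ 𝓝 1 := by
  have : CompleteSpace A := FiniteDimensional.complete ℝ A
  refine image_mem_nhds_one_of_hasStrictFDerivAt hf h𝔤 (D := (L₁.coprod L₂).coprod L₃) ?_ ?_ ?_ hB
  · simp only [hφ]
    exact hasStrictFDerivAt_mul_exp_clm (hasStrictFDerivAt_mul_exp_clm
      (hasStrictFDerivAt_exp_clm L₁) (by simp) L₂) (by simp) L₃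
  · exact hf.injective (by simp [hφ])
  · rwa [ContinuousLinearMap.coe_coprod, LinearMap.range_coprod, ContinuousLinearMap.coe_coprod,
      LinearMap.range_coprod]

end ClosedSubgroup

/-! ### Linear groups and the adjoint action -/

section InnerAutomorphisms

/-- The inner automorphisms `x ↦ u x u⁻¹` of an algebra. -/
def conjAlgAut (R A : Type*) [CommSemiring R] [Semiring A] [Algebra R A] : Aˣ →* A ≃ₐ[R] A :=
  (MulSemiringAction.toAlgAut (ConjAct Aˣ) R A).comp ConjAct.toConjAct.toMonoidHom

theorem conjAlgAut_apply {R A : Type*} [CommSemiring R] [Semiring A] [Algebra R A] (u : Aˣ)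
    (x : A) : conjAlgAut R A u x = u * x * ↑u⁻¹ :=
  rfl

theorem iSup_eigenspace_conj_eq_top {R M M' : Type*} [CommRing R] [AddCommGroup M] [Module R M]
    [AddCommGroup M'] [Module R M'] (e : M ≃ₗ[R] M') {f : Module.End R M}
    (hf : ⨆ c, f.eigenspace c = ⊤) : ⨆ c, Module.End.eigenspace (e.conj f) c = ⊤ := by
  have hmap (c : R) : (f.eigenspace c).map (e : M →ₗ[R] M') ≤
      Module.End.eigenspace (e.conj f) c := by
    rintro _ ⟨x, hx, rfl⟩
    rw [SetLike.mem_coe, Module.End.mem_eigenspace_iff] at hx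
    simp [LinearEquiv.conj_apply_apply, hx]
  rw [eq_top_iff, ← LinearEquiv.range e, LinearMap.range_eq_map, ← hf, Submodule.map_iSup]
  exact iSup_mono hmap

variable {n K : Type*} [Fintype n] [DecidableEq n] [Field K] {u : (Matrix n n K)ˣ} {d : n → K}

theorem iSup_eigenspace_conjAlgAut_eq_top_of_eq_diagonal
    (hu : (u : Matrix n n K) = Matrix.diagonal d) :
    ⨆ c, Module.End.eigenspace (conjAlgAut K (Matrix n n K) u).toLinearMap c = ⊤ := by
  have hd (j : n) : d j ≠ 0 :=
    (Pi.isUnit_iff.1 (Matrix.isUnit_diagonal.1 (hu ▸ u.isUnit)) j).ne_zero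
  refine eq_top_iff.2 fun X _ => ?_
  rw [Matrix.matrix_eq_sum_single X]
  refine Submodule.sum_mem _ fun i _ => Submodule.sum_mem _ fun j _ =>
    Submodule.mem_iSup_of_mem (d i / d j) ?_
  rw [Module.End.mem_eigenspace_iff, AlgEquiv.toLinearMap_apply, conjAlgAut_apply,
    Units.mul_inv_eq_iff_eq_mul, hu, Matrix.smul_mul]
  ext k l
  by_cases hk : i = k <;> by_cases hl : j = l <;>
    simp [Matrix.diagonal_mul, Matrix.mul_diagonal, Matrix.single, hk, hl, hd l,
      div_mul_eq_mul_div, ← mul_assoc]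

theorem iSup_eigenspace_conjAlgAut_eq_top {p : (Matrix n n K)ˣ}
    (hu : ((p * u * p⁻¹ : (Matrix n n K)ˣ) : Matrix n n K) = Matrix.diagonal d) :
    ⨆ c, Module.End.eigenspace (conjAlgAut K (Matrix n n K) u).toLinearMap c = ⊤ := by
  have hconj : (conjAlgAut K (Matrix n n K) p⁻¹).toLinearEquiv.conj
      (conjAlgAut K (Matrix n n K) (p * u * p⁻¹)).toLinearMap =
      (conjAlgAut K (Matrix n n K) u).toLinearMap := by
    ext1 X
    simp [LinearEquiv.conj_apply_apply, AlgEquiv.aut_inv]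
  rw [← hconj]
  exact iSup_eigenspace_conj_eq_top _ (iSup_eigenspace_conjAlgAut_eq_top_of_eq_diagonal hu)

end InnerAutomorphisms

theorem mem_of_mem_biSup_eigenspace {K V : Type*} [Field K] [AddCommGroup V] [Module K V]
    {f : Module.End K V} {S : Set K} {c : K} {v : V} (hv : v ∈ ⨆ c ∈ S, f.eigenspace c)
    (hfv : f v = c • v) (hv₀ : v ≠ 0) : c ∈ S := by
  by_contra hc
  have hle : ⨆ c ∈ S, f.eigenspace c ≤ ⨆ (c') (_ : c' ≠ c), f.eigenspace c' :=
    iSup₂_le fun c' hc' => le_iSup₂_of_le c' (fun h => hc (h ▸ hc')) le_rfl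
  exact hv₀ (Submodule.disjoint_def.1 (f.eigenspaces_iSupIndep c) v
    (Module.End.mem_eigenspace_iff.2 hfv) (hle hv))

/-- `W ^ k` is an eigenvector of `τ` for the eigenvalue `c ^ k`, so that `L` can be taken to be the
projection onto the eigenspace for `c`. -/
theorem exists_linearMap_apply_exp_eq {A : Type*} [NormedRing A] [NormedAlgebra ℝ A]
    [FiniteDimensional ℝ A] (τ : A →ₐ[ℝ] A) {c : ℝ} (hc : 1 < |c|) :
    ∃ L : A →ₗ[ℝ] A, ∀ W ∈ Module.End.eigenspace τ.toLinearMap c, L (NormedSpace.exp W) = W := by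
  have : CompleteSpace A := FiniteDimensional.complete ℝ A
  let _ : NormedAlgebra ℚ A := NormedAlgebra.restrictScalars ℚ ℝ A
  obtain ⟨E, hE, hcompl⟩ :=
    (Module.End.eigenspaces_iSupIndep τ.toLinearMap c).exists_isCompl
  refine ⟨E.projection _ hcompl, fun W hW => ?_⟩
  have hpow {k : ℕ} (hk : k ≠ 1) : E.projection _ hcompl (W ^ k) = 0 := by
    have hck : c ^ k ≠ c := fun h => hk <| pow_right_injective₀ (by linarith) hc.ne' <| by
      simp only [pow_one, ← abs_pow, h]
    refine (Submodule.projection_apply_eq_zero_iff hcompl).2 <|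
      Submodule.mem_iSup_of_mem (c ^ k) (Submodule.mem_iSup_of_mem hck ?_)
    rw [Module.End.mem_eigenspace_iff] at hW ⊢
    simpa [smul_pow] using congrArg (· ^ k) hW
  have hsum := (NormedSpace.exp_series_hasSum_exp' (𝕂 := ℝ) W).mapL
    (LinearMap.toContinuousLinearMap (E.projection _ hcompl))
  have hsingle := hasSum_single (f := fun k : ℕ => LinearMap.toContinuousLinearMap
    (E.projection _ hcompl) ((k.factorial⁻¹ : ℝ) • W ^ k)) 1 fun k hk => by simp [hpow hk]
  refine hsum.unique ?_
  simpa [Submodule.projection_apply_of_mem_left hcompl (hE hW)] using hsingle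

section LinearGroup

variable {N : ℕ}

/-- The inclusion of a linear group in the ring of matrices. -/
def toMatrixHom (G : Subgroup (Matrix.SpecialLinearGroup (Fin N) ℝ)) :
    G →* Matrix (Fin N) (Fin N) ℝ :=
  Matrix.SpecialLinearGroup.coeMonoidHom.comp G.subtype

theorem isEmbedding_toMatrixHom (G : Subgroup (Matrix.SpecialLinearGroup (Fin N) ℝ)) :
    IsEmbedding (toMatrixHom G) :=
  Matrix.SpecialLinearGroup.isClosedEmbedding_val.isEmbedding.comp .subtypeVal

theorem secondCountableTopology_subgroup (G : Subgroup (Matrix.SpecialLinearGroup (Fin N) ℝ)) :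
    SecondCountableTopology G :=
  have : SecondCountableTopology (Matrix (Fin N) (Fin N) ℝ) :=
    inferInstanceAs (SecondCountableTopology (Fin N → Fin N → ℝ))
  (isEmbedding_toMatrixHom G).secondCountableTopology

theorem exists_isOpen_isCoveredModulo_conj_subgroup
    {G : Subgroup (Matrix.SpecialLinearGroup (Fin N) ℝ)} (a : G) :
    ∃ K : ℕ, ∀ V ∈ 𝓝 (1 : G), ∃ U : Set G, IsOpen U ∧ 1 ∈ U ∧ U ⊆ V ∧
      IsCoveredModulo U K (MulAut.conj a '' U) := by
  let _ := Matrix.linftyOpNormedRing (n := Fin N) (α := ℝ)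
  let _ := Matrix.linftyOpNormedAlgebra (n := Fin N) (R := ℝ) (α := ℝ)
  have : ProperSpace (Matrix (Fin N) (Fin N) ℝ) := FiniteDimensional.proper ℝ _
  exact exists_isOpen_isCoveredModulo_conj (isEmbedding_toMatrixHom G).isInducing a

variable {G : Subgroup (Matrix.SpecialLinearGroup (Fin N) ℝ)}
  (hG : IsClosed (G : Set (Matrix.SpecialLinearGroup (Fin N) ℝ)))

include hG in
theorem isClosedEmbedding_toMatrixHom : IsClosedEmbedding (toMatrixHom G) :=
  Matrix.SpecialLinearGroup.isClosedEmbedding_val.comp hG.isClosedEmbedding_subtypeVal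

include hG in
theorem locallyCompactSpace_of_isClosed : LocallyCompactSpace G :=
  have : LocallyCompactSpace (Matrix (Fin N) (Fin N) ℝ) :=
    inferInstanceAs (LocallyCompactSpace (Fin N → Fin N → ℝ))
  (isClosedEmbedding_toMatrixHom hG).locallyCompactSpace

theorem toMatrixHom_expG (x : lieAlg hG) :
    toMatrixHom G (expG hG x) = NormedSpace.exp (x : Matrix (Fin N) (Fin N) ℝ) :=
  rfl

theorem expG_zero : expG hG 0 = 1 :=
  (isClosedEmbedding_toMatrixHom hG).injective (by simp [toMatrixHom_expG])

theorem mem_lieAlg_iff {X : Matrix (Fin N) (Fin N) ℝ} :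
    X ∈ lieAlg hG ↔ ∀ s : ℝ, NormedSpace.exp (s • X) ∈ MonoidHom.mrange (toMatrixHom G) :=
  forall_congr' fun _ =>
    ⟨fun ⟨g, hg, h⟩ => ⟨⟨g, hg⟩, h⟩, fun ⟨g, h⟩ => ⟨g, g.2, h⟩⟩

variable {a : G}

theorem coe_Ad_apply (x : lieAlg hG) :
    (Ad hG a x : Matrix (Fin N) (Fin N) ℝ) =
      conjAlgAut ℝ (Matrix (Fin N) (Fin N) ℝ) ((toMatrixHom G).toHomUnits a) x :=
  rfl

theorem IsClassA.iSup_eigenspace_eq_top (ha : IsClassA hG a) :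
    ⨆ c, (Ad hG a).eigenspace c = ⊤ := by
  obtain ⟨p, d, hpd⟩ := ha.semisimple
  have htop := iSup_eigenspace_conjAlgAut_eq_top (u := (toMatrixHom G).toHomUnits a)
    (p := Matrix.SpecialLinearGroup.toGL p) hpd
  have hmaps (x) (hx : x ∈ lieAlg hG) : (conjAlgAut ℝ (Matrix (Fin N) (Fin N) ℝ)
      ((toMatrixHom G).toHomUnits a)).toLinearMap x ∈ lieAlg hG :=
    (Ad hG a ⟨x, hx⟩).2
  have hAd : Ad hG a = LinearMap.restrict _ hmaps :=
    LinearMap.ext fun x => Subtype.ext (coe_Ad_apply hG x)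
  rw [hAd]
  exact Module.End.genEigenspace_restrict_eq_top hmaps htop

theorem IsClassA.gMinus_sup_gZero_sup_gPlus (ha : IsClassA hG a) :
    gMinus hG a ⊔ gZero hG a ⊔ gPlus hG a = ⊤ := by
  rw [eq_top_iff, ← ha.iSup_eigenspace_eq_top]
  refine iSup_le fun c => ?_
  by_cases hc : (Ad hG a).HasEigenvalue c
  · rcases lt_trichotomy |c| 1 with h | h | h
    · exact (le_iSup₂ (f := fun c (_ : |c| < 1) => (Ad hG a).eigenspace c) c h).trans
        (le_sup_left.trans le_sup_left)
    · rw [ha.eq_one c hc h]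
      exact le_sup_right.trans le_sup_left
    · exact (le_iSup₂ (f := fun c (_ : 1 < |c|) => (Ad hG a).eigenspace c) c h).trans le_sup_right
  · rw [Module.End.hasEigenvalue_iff, not_not] at hc
    exact hc.trans_le bot_le

theorem one_lt_abs_of_gPlus_eq {lam : ℝ} (hlam : (Ad hG a).HasEigenvalue lam)
    (hplus : gPlus hG a = (Ad hG a).eigenspace lam) : 1 < |lam| := by
  obtain ⟨x, hx⟩ := hlam.exists_hasEigenvector
  exact mem_of_mem_biSup_eigenspace (S := {c | 1 < |c|}) (hplus.ge hx.1) hx.apply_eq_smul hx.2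

theorem expG_Ad (x : lieAlg hG) : expG hG (Ad hG a x) = MulAut.conj a (expG hG x) := by
  refine (isClosedEmbedding_toMatrixHom hG).injective ?_
  rw [toMatrixHom_expG, MulAut.conj_apply, map_mul, map_mul, toMatrixHom_expG]
  let _ := Matrix.linftyOpNormedRing (n := Fin N) (α := ℝ)
  let _ := Matrix.linftyOpNormedAlgebra (n := Fin N) (R := ℝ) (α := ℝ)
  let _ : NormedAlgebra ℚ (Matrix (Fin N) (Fin N) ℝ) := NormedAlgebra.restrictScalars ℚ ℝ _
  exact NormedSpace.exp_units_conj ((toMatrixHom G).toHomUnits a) _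

end LinearGroup

/-! ### Boxes in exponential coordinates -/

section Boxes

variable {G A E F : Type*} [Group G] [TopologicalSpace G] [IsTopologicalGroup G]
  [NormedAddCommGroup E] [NormedAddCommGroup F] [NormedSpace ℝ F] {a : G} {φ : E × F → G}
  {S : E → E} {c : ℝ}

omit [TopologicalSpace G] [IsTopologicalGroup G] [NormedAddCommGroup E] in
theorem conj_pow_apply_prod (hconj : ∀ x z, MulAut.conj a (φ (x, z)) = φ (S x, c • z)) (k : ℕ)
    (x : E) (z : F) : MulAut.conj (a ^ k) (φ (x, z)) = φ (S^[k] x, c ^ k • z) := by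
  induction k with
  | zero => simp
  | succ k ih =>
    rw [pow_succ', map_mul, MulAut.mul_apply, ih, hconj, Function.iterate_succ_apply', smul_smul,
      pow_succ']

theorem norm_iterate_le (hS : ∀ x, ‖S x‖ ≤ ‖x‖) (k : ℕ) (x : E) : ‖S^[k] x‖ ≤ ‖x‖ := by
  induction k with
  | zero => rfl
  | succ k ih => exact Function.iterate_succ_apply' S k x ▸ (hS _).trans ih

variable [NormedRing A] {f : G →* A} {D : ℝ≥0}

omit [NormedSpace ℝ F] in
/-- The `F`-coordinate is bounded by `φ (0, z) = (φ (x, 0))⁻¹ * φ (x, z)`. -/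
theorem exists_norm_snd_lt [ProperSpace E] (hf : Continuous f) (hφ : Continuous φ)
    (hφmul : ∀ x z, φ (x, z) = φ (x, 0) * φ (0, z)) (hD : ∀ z, ‖z‖ ≤ D * ‖f (φ (0, z))‖)
    (s : ℝ) : ∃ C > 0, ∃ V ∈ 𝓝 (1 : G), ∀ x z, ‖x‖ ≤ s → φ (x, z) ∈ V → ‖z‖ < C := by
  obtain ⟨B, hB⟩ : ∃ B, ∀ x ∈ Metric.closedBall (0 : E) s, ‖f (φ (x, 0))⁻¹‖ ≤ B :=
    (isCompact_closedBall 0 s).exists_bound_of_continuousOn (by fun_prop)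
  refine ⟨D * (max B 0 * (‖(1 : A)‖ + 1)) + 1, by positivity, {g | ‖f g‖ < ‖(1 : A)‖ + 1},
    (isOpen_lt (by fun_prop) continuous_const).mem_nhds (by simp), fun x z hx hxz => ?_⟩
  refine (hD z).trans_lt (lt_add_one _ |>.trans_le' ?_)
  gcongr
  calc ‖f (φ (0, z))‖ = ‖f (φ (x, 0))⁻¹ * f (φ (x, z))‖ := by
        rw [← map_mul, hφmul x z, inv_mul_cancel_left]
    _ ≤ ‖f (φ (x, 0))⁻¹‖ * ‖f (φ (x, z))‖ := norm_mul_le _ _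
    _ ≤ max B 0 * (‖(1 : A)‖ + 1) := by
        gcongr
        · exact (hB x (by simpa using hx)).trans (le_max_left _ _)
        · exact hxz.le

theorem expandingBoxes_image [ProperSpace E] (hf : Continuous f) (hφ : Continuous φ)
    (hφ₀ : φ 0 = 1) (hφmul : ∀ x z, φ (x, z) = φ (x, 0) * φ (0, z))
    (hφnhds : ∀ B ∈ 𝓝 0, φ '' B ∈ 𝓝 1) (hD : ∀ z, ‖z‖ ≤ D * ‖f (φ (0, z))‖)
    (hS : ∀ x, ‖S x‖ ≤ ‖x‖) (hc : c ≠ 0)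
    (hconj : ∀ x z, MulAut.conj a (φ (x, z)) = φ (S x, c • z)) :
    ExpandingBoxes a |c|⁻¹ fun s r => φ '' (Metric.ball 0 s ×ˢ Metric.ball 0 r) where
  mono s r r' h := by dsimp only; gcongr
  mem_nhds hs hr := hφnhds _ (prod_mem_nhds (Metric.ball_mem_nhds 0 hs) (Metric.ball_mem_nhds 0 hr))
  conj_mem V hV := by
    obtain ⟨s₁, hs₁, hball⟩ := Metric.mem_nhds_iff.1
      (hφ.continuousAt.preimage_mem_nhds (hφ₀.symm ▸ hV))
    refine ⟨s₁, hs₁, fun s _ hs l _ => ?_⟩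
    rintro ⟨⟨x, z⟩, ⟨hx, hz⟩, rfl⟩
    rw [conj_pow_apply_prod hconj]
    rw [mem_ball_zero_iff] at hx hz
    refine hball (mem_ball_zero_iff.2 (max_lt ?_ ?_))
    · exact ((norm_iterate_le hS l x).trans_lt hx).trans_le hs
    · rw [norm_smul, norm_pow, Real.norm_eq_abs]
      rw [inv_pow, ← div_eq_mul_inv, lt_div_iff₀' (by positivity)] at hz
      exact hz.trans_le hs
  mem_of_conj_mem s hs := by
    obtain ⟨C, hC, V, hV, hVC⟩ := exists_norm_snd_lt hf hφ hφmul hD s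
    refine ⟨C, hC, φ '' (Metric.ball 0 s ×ˢ Set.univ) ∩ V,
      inter_mem (hφnhds _ (prod_mem_nhds (Metric.ball_mem_nhds 0 hs) univ_mem)) hV, ?_⟩
    rintro _ ⟨⟨⟨x, z⟩, ⟨hx, -⟩, rfl⟩, -⟩ k ⟨-, hk⟩
    refine ⟨(x, z), ⟨hx, ?_⟩, rfl⟩
    rw [mem_ball_zero_iff] at hx ⊢
    rw [conj_pow_apply_prod hconj] at hk
    have hz := hVC _ _ ((norm_iterate_le hS k x).trans hx.le) hk
    rwa [norm_smul, norm_pow, Real.norm_eq_abs, ← lt_div_iff₀' (by positivity), div_eq_mul_inv,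
      ← inv_pow] at hz

theorem measurableSet_image_of_isOpen {Y Z : Type*} [TopologicalSpace Y]
    [LocallyCompactSpace Y] [SecondCountableTopology Y] [TopologicalSpace Z] [T2Space Z]
    [MeasurableSpace Z] [BorelSpace Z] {g : Y → Z} (hg : Continuous g) {B : Set Y}
    (hB : IsOpen B) : MeasurableSet (g '' B) := by
  have : LocallyCompactSpace B := hB.locallyCompactSpace
  have hσ : IsSigmaCompact B := isSigmaCompact_iff_sigmaCompactSpace.2 inferInstance
  obtain ⟨K, hK, hKB⟩ := hσ.image hg
  rw [← hKB]
  exact MeasurableSet.iUnion fun n => (hK n).measurableSet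

end Boxes

theorem exists_norm_le_mul_norm_exp {A F : Type*} [NormedRing A] [NormedAlgebra ℝ A]
    [FiniteDimensional ℝ A] [NormedAddCommGroup F] [NormedSpace ℝ F] [FiniteDimensional ℝ F]
    (τ : A →ₐ[ℝ] A) {c : ℝ} (hc : 1 < |c|) {L : F →ₗ[ℝ] A} (hL : Function.Injective L)
    (hLτ : ∀ z, τ (L z) = c • L z) :
    ∃ D : ℝ≥0, ∀ z, ‖z‖ ≤ D * ‖NormedSpace.exp (L z)‖ := by
  obtain ⟨P, hP⟩ := exists_linearMap_apply_exp_eq τ hc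
  obtain ⟨K, -, hK⟩ := L.exists_antilipschitzWith (LinearMap.ker_eq_bot.2 hL)
  refine ⟨K * ‖LinearMap.toContinuousLinearMap P‖₊, fun z => ?_⟩
  calc ‖z‖ ≤ K * ‖L z‖ := by simpa using hK.le_mul_norm_sub z 0
    _ = K * ‖LinearMap.toContinuousLinearMap P (NormedSpace.exp (L z))‖ := by
        rw [LinearMap.coe_toContinuousLinearMap', hP _ (Module.End.mem_eigenspace_iff.2 (hLτ z))]
    _ ≤ K * (‖LinearMap.toContinuousLinearMap P‖ * ‖NormedSpace.exp (L z)‖) := by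
        gcongr
        exact (LinearMap.toContinuousLinearMap P).le_opNorm _
    _ = _ := by push_cast; rw [mul_assoc]

/-! ### The sets `exp(B⁻_s) exp(B⁰_s) exp(B⁺_r)` -/

section Coordinates

variable {E : Type*} [AddCommGroup E] [Module ℝ E] {V : Submodule ℝ E} {n : ℕ}
  (b : Module.Basis (Fin n) ℝ V)

/-- The parametrization of a subspace by the coordinates in a basis. -/
noncomputable def coordMap : (Fin n → ℝ) →ₗ[ℝ] E :=
  V.subtype ∘ₗ b.equivFun.symm

theorem range_coordMap : LinearMap.range (coordMap b) = V := by
  simp [coordMap, LinearMap.range_comp]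

theorem coordMap_injective : Function.Injective (coordMap b) :=
  V.subtype_injective.comp b.equivFun.symm.injective

theorem apply_coordMap {f : Module.End ℝ E} {c : Fin n → ℝ}
    (hb : ∀ i, f (b i) = c i • (b i : E)) (x : Fin n → ℝ) :
    f (coordMap b x) = coordMap b (c * x) := by
  simp [coordMap, Module.Basis.equivFun_symm_apply, hb, smul_smul, mul_comm]

theorem coordMap_apply (x : Fin n → ℝ) : coordMap b x = b.equivFun.symm x :=
  rfl

theorem exists_mem_supBall_zero_iff {r : ℝ} {p : V → Prop} :
    (∃ x ∈ supBall b 0 r, p x) ↔ ∃ x ∈ Metric.ball 0 r, p (b.equivFun.symm x) := by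
  simp only [b.equivFun.symm.surjective.exists, supBall, Set.mem_ofPred_eq, sub_zero,
    LinearEquiv.apply_symm_apply, mem_ball_zero_iff]

end Coordinates

section Tubes

variable {N : ℕ} {G : Subgroup (Matrix.SpecialLinearGroup (Fin N) ℝ)}
  {hG : IsClosed (G : Set (Matrix.SpecialLinearGroup (Fin N) ℝ))} {a : G} {lam : ℝ}
  {nm nz np : ℕ} (bm : Module.Basis (Fin nm) ℝ (gMinus hG a))
  (b0 : Module.Basis (Fin nz) ℝ (gZero hG a)) (bp : Module.Basis (Fin np) ℝ (gPlus hG a))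

/-- The parametrization `((x, y), z) ↦ exp(x) exp(y) exp(z)` of a neighbourhood of `1` by the
coordinates in `𝔤₋`, `𝔤₀` and `𝔤₊`. -/
noncomputable def tubeMap (p : ((Fin nm → ℝ) × (Fin nz → ℝ)) × (Fin np → ℝ)) : G :=
  expG hG (coordMap bm p.1.1) * expG hG (coordMap b0 p.1.2) * expG hG (coordMap bp p.2)

theorem tube_zero_eq_image (s r : ℝ) :
    tube bm b0 bp s r 0 = tubeMap bm b0 bp '' (Metric.ball 0 s ×ˢ Metric.ball 0 r) := by
  ext g
  calc g ∈ tube bm b0 bp s r 0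
      ↔ ∃ x : gMinus hG a, x ∈ supBall bm 0 s ∧ ∃ y : gZero hG a, y ∈ supBall b0 0 s ∧
          ∃ z : gPlus hG a, z ∈ supBall bp 0 r ∧ expG hG x * expG hG y * expG hG z = g := by
        simp only [tube, Set.mem_ofPred_eq, eq_comm (a := g), exists_and_left]
    _ ↔ g ∈ tubeMap bm b0 bp '' ((Metric.ball 0 s ×ˢ Metric.ball 0 s) ×ˢ Metric.ball 0 r) := by
        simp only [exists_mem_supBall_zero_iff, ← coordMap_apply, Set.mem_image, Prod.exists,
          Set.mem_prod, tubeMap, and_assoc, exists_and_left]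
    _ ↔ _ := by rw [ball_prod_same, Prod.mk_zero_zero]

theorem tubeMap_zero : tubeMap bm b0 bp 0 = 1 := by
  simp [tubeMap, expG_zero]

theorem tubeMap_eq_mul (x : (Fin nm → ℝ) × (Fin nz → ℝ)) (z : Fin np → ℝ) :
    tubeMap bm b0 bp (x, z) = tubeMap bm b0 bp (x, 0) * tubeMap bm b0 bp (0, z) := by
  simp [tubeMap, expG_zero]

theorem continuous_expG_coordMap {V : Submodule ℝ (lieAlg hG)} {n : ℕ}
    (b : Module.Basis (Fin n) ℝ V) : Continuous fun x => expG hG (coordMap b x) := by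
  let _ := Matrix.linftyOpNormedRing (n := Fin N) (α := ℝ)
  let _ := Matrix.linftyOpNormedAlgebra (n := Fin N) (R := ℝ) (α := ℝ)
  let _ : NormedAlgebra ℚ (Matrix (Fin N) (Fin N) ℝ) := NormedAlgebra.restrictScalars ℚ ℝ _
  have hL := ((lieAlg hG).subtype ∘ₗ coordMap b).continuous_of_finiteDimensional
  exact (isClosedEmbedding_toMatrixHom hG).continuous_iff.2 (NormedSpace.exp_continuous.comp hL)

theorem continuous_tubeMap : Continuous (tubeMap bm b0 bp) :=
  (((continuous_expG_coordMap bm).comp (by fun_prop)).mul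
    ((continuous_expG_coordMap b0).comp (by fun_prop))).mul
    ((continuous_expG_coordMap bp).comp continuous_snd)

theorem Ad_coordMap_gPlus (hplus : gPlus hG a = (Ad hG a).eigenspace lam) (z : Fin np → ℝ) :
    Ad hG a (coordMap bp z) = lam • coordMap bp z := by
  rw [← Module.End.mem_eigenspace_iff, ← hplus]
  exact (bp.equivFun.symm z).2

theorem conj_tubeMap {c : Fin nm → ℝ} (hc : ∀ i, Ad hG a (bm i) = c i • (bm i : lieAlg hG))
    (hplus : gPlus hG a = (Ad hG a).eigenspace lam) (x : (Fin nm → ℝ) × (Fin nz → ℝ))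
    (z : Fin np → ℝ) : MulAut.conj a (tubeMap bm b0 bp (x, z)) =
      tubeMap bm b0 bp ((c * x.1, x.2), lam • z) := by
  have h0 : Ad hG a (coordMap b0 x.2) = coordMap b0 x.2 := by
    have h := apply_coordMap b0 (f := Ad hG a) (c := 1)
      (fun i => Module.End.mem_eigenspace_iff.1 (b0 i).2) x.2
    rwa [one_mul] at h
  simp only [tubeMap, map_mul, ← expG_Ad, h0, Ad_coordMap_gPlus bp hplus, map_smul,
    apply_coordMap bm hc]

theorem tubeMap_image_mem_nhds_one (hspan : gMinus hG a ⊔ gZero hG a ⊔ gPlus hG a = ⊤)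
    {B : Set (((Fin nm → ℝ) × (Fin nz → ℝ)) × (Fin np → ℝ))} (hB : B ∈ 𝓝 0) :
    tubeMap bm b0 bp '' B ∈ 𝓝 1 := by
  let _ := Matrix.linftyOpNormedRing (n := Fin N) (α := ℝ)
  let _ := Matrix.linftyOpNormedAlgebra (n := Fin N) (R := ℝ) (α := ℝ)
  have hrange {V : Submodule ℝ (lieAlg hG)} {n : ℕ} (b : Module.Basis (Fin n) ℝ V) :
      LinearMap.range ((lieAlg hG).subtype ∘ₗ coordMap b) = V.map (lieAlg hG).subtype := by
    rw [LinearMap.range_comp, range_coordMap]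
  refine image_mem_nhds_one_of_eq_exp_mul_exp_mul_exp (isClosedEmbedding_toMatrixHom hG)
    (fun X => (mem_lieAlg_iff hG).2)
    (LinearMap.toContinuousLinearMap ((lieAlg hG).subtype ∘ₗ coordMap bm))
    (LinearMap.toContinuousLinearMap ((lieAlg hG).subtype ∘ₗ coordMap b0))
    (LinearMap.toContinuousLinearMap ((lieAlg hG).subtype ∘ₗ coordMap bp)) ?_
    (fun p => by rw [tubeMap, map_mul, map_mul]; rfl) hB
  simp only [LinearMap.coe_toContinuousLinearMap, hrange]
  rw [← Submodule.map_sup, ← Submodule.map_sup, hspan, Submodule.map_subtype_top]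

theorem expandingBoxes_tube (hlam : 1 < |lam|) (hplus : gPlus hG a = (Ad hG a).eigenspace lam)
    (hspan : gMinus hG a ⊔ gZero hG a ⊔ gPlus hG a = ⊤)
    (hbm : ∀ i, ∃ c : ℝ, Ad hG a (bm i) = c • (bm i : lieAlg hG)) :
    ExpandingBoxes a |lam|⁻¹ fun s r => tube bm b0 bp s r 0 := by
  choose c hc using hbm
  have hc1 (i) : |c i| < 1 := mem_of_mem_biSup_eigenspace (S := {c | |c| < 1}) (bm i).2 (hc i)
    fun h => bm.ne_zero i (Subtype.ext h)
  have hS (x : (Fin nm → ℝ) × (Fin nz → ℝ)) : ‖(c * x.1, x.2)‖ ≤ ‖x‖ := by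
    have hcn : ‖c‖ ≤ 1 := (pi_norm_le_iff_of_nonneg zero_le_one).2 fun i => (hc1 i).le
    exact max_le_max_right _ ((norm_mul_le _ _).trans (mul_le_of_le_one_left (norm_nonneg _) hcn))
  let _ := Matrix.linftyOpNormedRing (n := Fin N) (α := ℝ)
  let _ := Matrix.linftyOpNormedAlgebra (n := Fin N) (R := ℝ) (α := ℝ)
  obtain ⟨D, hD⟩ := exists_norm_le_mul_norm_exp
    (conjAlgAut ℝ (Matrix (Fin N) (Fin N) ℝ) ((toMatrixHom G).toHomUnits a)).toAlgHom hlam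
    (L := (lieAlg hG).subtype ∘ₗ coordMap bp)
    ((lieAlg hG).subtype_injective.comp (coordMap_injective bp))
    fun z => congrArg Subtype.val (Ad_coordMap_gPlus bp hplus z)
  have hD' (z : Fin np → ℝ) : ‖z‖ ≤ D * ‖toMatrixHom G (tubeMap bm b0 bp (0, z))‖ := by
    have htube : tubeMap bm b0 bp (0, z) = expG hG (coordMap bp z) := by simp [tubeMap, expG_zero]
    exact htube ▸ hD z
  simp only [tube_zero_eq_image]
  exact expandingBoxes_image (S := fun x => (c * x.1, x.2))
    (isEmbedding_toMatrixHom G).continuous (continuous_tubeMap bm b0 bp) (tubeMap_zero bm b0 bp)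
    (tubeMap_eq_mul bm b0 bp)
    (fun B => tubeMap_image_mem_nhds_one bm b0 bp hspan) hD' hS (abs_pos.1 (by linarith))
    (conj_tubeMap bm b0 bp hc hplus)

theorem measurableSet_smul_image_tube {Γ : Subgroup G} [T2Space (CosetSpace Γ)] (s r : ℝ)
    (x : CosetSpace Γ) : MeasurableSet ((· • x) '' tube bm b0 bp s r 0) := by
  rw [tube_zero_eq_image, Set.image_image]
  exact measurableSet_image_of_isOpen
    ((CosetSpace.continuous_smul_left Γ x).comp (continuous_tubeMap bm b0 bp))
    (Metric.isOpen_ball.prod Metric.isOpen_ball)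

variable {bm b0 bp}

theorem HasLocalDimension.hasBoxDimension {Γ : Subgroup G} {μ : Measure (CosetSpace Γ)} {κ : ℝ}
    (hμ : HasLocalDimension bm b0 bp μ κ) :
    HasBoxDimension (fun s r => tube bm b0 bp s r 0) μ κ := by
  obtain ⟨hsupp, s₀, hs₀, l, hl, C, h⟩ := hμ
  refine ⟨hsupp, s₀, hs₀, l, hl, C, fun s s' δ x hs' hs's hs => ?_⟩
  exact h s s' δ 0 x hs' hs's hs (by simpa [supBall] using hs'.trans_le hs's)
    fun z hz => hz.trans_le hs's

end Tubes

/-! ### Entropy from the measure of Bowen sets -/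

section Entropy

variable {G X : Type*} [Group G] [TopologicalSpace G] [IsTopologicalGroup G] [MulAction G X]
  [TopologicalSpace X] [T2Space X] [MeasurableSpace X] [BorelSpace X] {a : G}

theorem isOpen_bowenSet (a : G) {U : Set G} (hU : IsOpen U) (n : ℕ) : IsOpen (bowenSet a U n) := by
  have hbowen : bowenSet a U n = ⋂ k ∈ Finset.Iic n, MulAut.conj (a ^ k) ⁻¹' U := by
    ext g
    simp [bowenSet]
  rw [hbowen]
  exact isOpen_biInter_finset fun k _ =>
    hU.preimage (f := fun g => a ^ k * g * (a ^ k)⁻¹) (by fun_prop)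

theorem ofReal_neg_log_sub_le_measureEntropy {ν : Measure X} [IsProbabilityMeasure ν]
    (hT : MeasurePreserving (fun x : X => a • x) ν ν) (hop : ∀ x : X, IsOpenMap (· • x : G → X))
    {K : ℕ} (hcover : ∀ V ∈ 𝓝 (1 : G), ∃ U : Set G, IsOpen U ∧ 1 ∈ U ∧ U ⊆ V ∧
      IsCoveredModulo U K (MulAut.conj a '' U))
    {θ : ℝ} (hθ : 0 < θ) (hKθ : 1 ≤ K * θ) {Q : Set X} (hQ : IsCompact Q) {V₁ V₂ : Set G}
    (hV₁ : V₁ ∈ 𝓝 1) (hinj : ∀ x ∈ Q, V₁.InjOn (· • x)) (hV₂ : V₂ ∈ 𝓝 1) {C : ℝ}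
    (hC : ∀ U ⊆ V₂, IsOpen U → ∀ n, ∀ z ∈ Q,
      ν ((· • z) '' bowenSet a U n) ≤ ENNReal.ofReal (C * θ ^ n)) :
    ENNReal.ofReal (-Real.log θ - Real.log K * ν.real Qᶜ) ≤
      measureEntropy (fun x : X => a • x) ν := by
  obtain ⟨W, hWo, hW1, hWV₁⟩ := exists_isOpen_div_subset hV₁
  have hWV₁' : W ⊆ V₁ := fun g hg => hWV₁ ⟨g, hg, 1, hW1, div_one g⟩
  have hconj : MulAut.conj a ⁻¹' V₁ ∈ 𝓝 1 :=
    (show Continuous fun g => a * g * a⁻¹ by fun_prop).continuousAt.preimage_mem_nhds (by simpa)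
  obtain ⟨U, hUo, hU1, hUV, hUK⟩ := hcover _
    (inter_mem (hWo.mem_nhds hW1) (inter_mem hconj hV₂))
  have hUW : U ⊆ W := fun g hg => (hUV hg).1
  have hbowen : ∀ n, ∀ z ∈ Q, ν ((· • z) '' bowenSet a U n) ≤
      ENNReal.ofReal (max 1 (C / θ) * θ ^ (n + 1)) := fun n z hz =>
    (hC U (fun g hg => (hUV hg).2.2) hUo n z hz).trans <| ENNReal.ofReal_le_ofReal <|
      calc C * θ ^ n = C / θ * θ ^ (n + 1) := by rw [pow_succ']; field_simp
        _ ≤ max 1 (C / θ) * θ ^ (n + 1) := by gcongr; exact le_max_right _ _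
  obtain ⟨ξ, R, hξm, hξR, hξ⟩ := exists_isLabelling hop hQ hQ.measurableSet (hUo.mem_nhds hU1)
  have hcylinder := hξ.measureReal_cylinder_le hξm hT hinj (hUW.trans hWV₁')
    ((Set.div_subset_div hUW hUW).trans hWV₁) (Set.image_subset_iff.2 fun g hg => (hUV hg).2.1)
    hUK (le_max_left _ _) hθ hKθ hbowen
  have hQc : ξ ⁻¹' {0} = Qᶜ := by
    ext x
    exact not_iff_comm.1 (hξ.ne_zero_iff x) |>.symm
  rw [← hQc]
  have hK : (0 : ℝ) < K := pos_of_mul_pos_left (zero_lt_one.trans_le hKθ) hθ.le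
  refine (entropyOfPartition_ge hT hξm (lt_max_of_lt_left zero_lt_one) hK hθ fun m v => by
    simpa only [smul_iterate] using hcylinder m v).trans ?_
  exact le_iSup₂_of_le ξ hξm <| le_iSup_of_le (partitionEntropy_lt_top_of_le hξR) le_rfl

theorem ofReal_neg_log_le_measureEntropy {ν : Measure X} [IsProbabilityMeasure ν]
    [ν.InnerRegularCompactLTTop] (hT : MeasurePreserving (fun x : X => a • x) ν ν)
    (hop : ∀ x : X, IsOpenMap (· • x : G → X))
    (hinj : ∀ Q : Set X, IsCompact Q → ∃ V ∈ 𝓝 (1 : G), ∀ x ∈ Q, V.InjOn (· • x))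
    {K : ℕ} (hcover : ∀ V ∈ 𝓝 (1 : G), ∃ U : Set G, IsOpen U ∧ 1 ∈ U ∧ U ⊆ V ∧
      IsCoveredModulo U K (MulAut.conj a '' U)) {θ : ℝ} (hθ : 0 < θ)
    (hbowen : ∀ Q : Set X, IsCompact Q → ∃ V ∈ 𝓝 (1 : G), ∃ C : ℝ, ∀ U ⊆ V, IsOpen U →
      ∀ n, ∀ z ∈ Q, ν ((· • z) '' bowenSet a U n) ≤ ENNReal.ofReal (C * θ ^ n)) :
    ENNReal.ofReal (-Real.log θ) ≤ measureEntropy (fun x : X => a • x) ν := by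
  set L : ℕ := max K ⌈θ⁻¹⌉₊
  have hLθ : 1 ≤ L * θ :=
    calc (1 : ℝ) = θ⁻¹ * θ := (inv_mul_cancel₀ hθ.ne').symm
      _ ≤ L * θ := by
        gcongr
        exact (Nat.le_ceil _).trans (Nat.cast_le.2 (le_max_right _ _))
  have hcover' : ∀ V ∈ 𝓝 (1 : G), ∃ U : Set G, IsOpen U ∧ 1 ∈ U ∧ U ⊆ V ∧
      IsCoveredModulo U L (MulAut.conj a '' U) := fun V hV =>
    let ⟨U, hUo, hU1, hUV, hUK⟩ := hcover V hV
    ⟨U, hUo, hU1, hUV, hUK.mono_card (le_max_left _ _)⟩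
  have hcontinuous : Continuous fun ε : ℝ => ENNReal.ofReal (-Real.log θ - Real.log L * ε) :=
    ENNReal.continuous_ofReal.comp (by fun_prop)
  have hlim : Tendsto (fun ε : ℝ => ENNReal.ofReal (-Real.log θ - Real.log L * ε)) (𝓝[>] 0)
      (𝓝 (ENNReal.ofReal (-Real.log θ))) := by
    simpa using (hcontinuous.tendsto 0).mono_left nhdsWithin_le_nhds
  refine le_of_tendsto hlim <| eventually_mem_nhdsWithin.mono fun ε (hε : 0 < ε) => ?_
  obtain ⟨Q, -, hQ, hνQ⟩ := MeasurableSet.univ.exists_isCompact_sdiff_lt (measure_ne_top ν _)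
    (ENNReal.ofReal_pos.2 hε).ne'
  have hνQ' : ν.real Qᶜ ≤ ε :=
    ENNReal.toReal_le_of_le_ofReal hε.le (Set.compl_eq_univ_sdiff Q ▸ hνQ.le)
  obtain ⟨V₁, hV₁, hinjQ⟩ := hinj Q hQ
  obtain ⟨V₂, hV₂, C, hC⟩ := hbowen Q hQ
  refine (ENNReal.ofReal_le_ofReal ?_).trans
    (ofReal_neg_log_sub_le_measureEntropy hT hop hcover' hθ hLθ hQ hV₁ hinjQ hV₂ hC)
  gcongr

end Entropy

/-! ### Entropy of limit points of averages -/

section LimitPoint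

theorem IsWeakStarLimitPoint.measure_univ_le_one {X : Type*} [TopologicalSpace X] [T2Space X]
    [LocallyCompactSpace X] [MeasurableSpace X] [BorelSpace X] {ρ μ : Measure X} [ρ.Regular]
    [IsProbabilityMeasure μ] {T : X → X} (hT : Measurable T)
    (h : IsWeakStarLimitPoint ρ (cesaroAverage T μ)) : ρ Set.univ ≤ 1 := by
  refine h.measure_le_of_isOpen isOpen_univ ENNReal.one_ne_top (cesaroAverage_apply_le fun l => ?_)
  rw [Measure.map_apply (hT.iterate l) .univ]
  exact prob_le_one

variable {G X : Type*} [Group G] [TopologicalSpace G] [IsTopologicalGroup G]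
  [LocallyCompactSpace G] [MulAction G X] [TopologicalSpace X] [ContinuousConstSMul G X] [T2Space X]
  [LocallyCompactSpace X] [HereditarilyLindelofSpace X] [MeasurableSpace X] [BorelSpace X] {a : G}
  {q κ : ℝ} {F : ℝ → ℝ → Set G} {μ ρ : Measure X} [IsProbabilityMeasure μ] [ρ.Regular]

theorem HasBoxDimension.exists_limitPoint_bowenSet_le (hμ : HasBoxDimension F μ κ) (hκ : 0 ≤ κ)
    (hF : ExpandingBoxes a q F) (hq : 0 < q) (hq1 : q ≤ 1)
    (hFm : ∀ s r (x : X), MeasurableSet ((· • x) '' F s r))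
    (hop : ∀ x : X, IsOpenMap (· • x : G → X))
    (hρ : IsWeakStarLimitPoint ρ (cesaroAverage (fun x => a • x) μ))
    {Q : Set X} {V₀ : Set G} (hV₀ : V₀ ∈ 𝓝 1) (hinj : ∀ z ∈ Q, V₀.InjOn (· • z)) :
    ∃ V ∈ 𝓝 (1 : G), ∃ C : ℝ, ∀ U ⊆ V, IsOpen U → ∀ n, ∀ z ∈ Q,
      ρ ((· • z) '' bowenSet a U n) ≤ ENNReal.ofReal (C * (q ^ κ) ^ n) := by
  obtain ⟨V, hV, C, hC⟩ := hμ.exists_measure_bowenSet_le hκ hF hq hq1 hFm hop hV₀ hinj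
  refine ⟨V, hV, C, fun U hU hUo n z hz => ?_⟩
  have hO := hop z _ (isOpen_bowenSet a hUo n)
  refine hρ.measure_le_of_isOpen hO ENNReal.ofReal_ne_top (cesaroAverage_apply_le fun l => ?_)
  rw [smul_iterate, Measure.map_apply (continuous_const_smul _).measurable hO.measurableSet]
  exact hC U hU n l z hz

theorem HasBoxDimension.isProbabilityMeasure_and_le_measureEntropy (hμ : HasBoxDimension F μ κ)
    (hκ : 0 ≤ κ) (hF : ExpandingBoxes a q F) (hq : 0 < q) (hq1 : q ≤ 1)
    (hFm : ∀ s r (x : X), MeasurableSet ((· • x) '' F s r))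
    (hop : ∀ x : X, IsOpenMap (· • x : G → X))
    (hinj : ∀ Q : Set X, IsCompact Q → ∃ V ∈ 𝓝 (1 : G), ∀ x ∈ Q, V.InjOn (· • x))
    {K : ℕ} (hcover : ∀ V ∈ 𝓝 (1 : G), ∃ U : Set G, IsOpen U ∧ 1 ∈ U ∧ U ⊆ V ∧
      IsCoveredModulo U K (MulAut.conj a '' U))
    (hρ : IsWeakStarLimitPoint ρ (cesaroAverage (fun x => a • x) μ)) (hpos : 0 < ρ Set.univ) :
    IsProbabilityMeasure ((ρ Set.univ)⁻¹ • ρ) ∧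
      MeasurePreserving (fun x : X => a • x) ((ρ Set.univ)⁻¹ • ρ) ((ρ Set.univ)⁻¹ • ρ) ∧
      ENNReal.ofReal (-(κ * Real.log q)) ≤
        measureEntropy (fun x : X => a • x) ((ρ Set.univ)⁻¹ • ρ) := by
  have hfin : IsFiniteMeasure ρ :=
    ⟨(hρ.measure_univ_le_one (continuous_const_smul a).measurable).trans_lt ENNReal.one_lt_top⟩
  have hne : NeZero ρ := ⟨Measure.measure_univ_pos.1 hpos⟩
  have hinv : (ρ Set.univ)⁻¹ ≠ ∞ := ENNReal.inv_ne_top.2 hpos.ne'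
  have hinvariant : MeasurePreserving (fun x : X => a • x) ρ ρ :=
    IsWeakStarLimitPoint.measurePreserving (T := Homeomorph.smul a) hρ
  have hT := hinvariant.smul_measure (ρ Set.univ)⁻¹
  refine ⟨inferInstance, hT, ?_⟩
  rw [← Real.log_rpow hq]
  refine ofReal_neg_log_le_measureEntropy hT hop hinj hcover (Real.rpow_pos_of_pos hq κ)
    fun Q hQ => ?_
  obtain ⟨V₀, hV₀, hinjQ⟩ := hinj Q hQ
  obtain ⟨V, hV, C, hC⟩ :=
    hμ.exists_limitPoint_bowenSet_le hκ hF hq hq1 hFm hop hρ hV₀ hinjQ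
  refine ⟨V, hV, (ρ Set.univ)⁻¹.toReal * C, fun U hU hUo n z hz => ?_⟩
  rw [Measure.smul_apply, smul_eq_mul, mul_assoc, ENNReal.ofReal_mul ENNReal.toReal_nonneg,
    ENNReal.ofReal_toReal hinv]
  gcongr
  exact hC U hU hUo n z hz

end LimitPoint

end HomDyn

theorem mainTheorem4_general {N : ℕ} (G : Subgroup (Matrix.SpecialLinearGroup (Fin N) ℝ))
    (hG : IsClosed (G : Set (Matrix.SpecialLinearGroup (Fin N) ℝ)))
    (Γ : Subgroup G) [DiscreteTopology Γ] (a : G)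
    (hspan : gMinus hG a ⊔ gZero hG a ⊔ gPlus hG a = ⊤)
    (lam : ℝ) (hlam : (Ad hG a).HasEigenvalue lam) (hplus : gPlus hG a = (Ad hG a).eigenspace lam)
    {nm nz np : ℕ}
    (bm : Module.Basis (Fin nm) ℝ (gMinus hG a))
    (hbm : ∀ i, ∃ c : ℝ, Ad hG a (bm i) = c • (bm i : lieAlg hG))
    (b0 : Module.Basis (Fin nz) ℝ (gZero hG a))
    (bp : Module.Basis (Fin np) ℝ (gPlus hG a))
    (μ : Measure (CosetSpace Γ)) [IsProbabilityMeasure μ]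
    (κ : ℝ) (hκ : 0 ≤ κ) (hμ : HasLocalDimension bm b0 bp μ κ)
    (ρ : Measure (CosetSpace Γ)) [IsFiniteMeasureOnCompacts ρ]
    (hρ : IsWeakStarLimitPoint ρ (cesaroAverage (fun x => a • x) μ))
    (hpos : 0 < ρ Set.univ) :
    IsProbabilityMeasure ((ρ Set.univ)⁻¹ • ρ) ∧
      MeasurePreserving (fun x : CosetSpace Γ => a • x)
        ((ρ Set.univ)⁻¹ • ρ) ((ρ Set.univ)⁻¹ • ρ) ∧
      ENNReal.ofReal (κ * Real.log |lam|) ≤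
        measureEntropy (fun x : CosetSpace Γ => a • x) ((ρ Set.univ)⁻¹ • ρ) := by
  have : LocallyCompactSpace G := locallyCompactSpace_of_isClosed hG
  have : SecondCountableTopology G := secondCountableTopology_subgroup G
  have : T2Space (CosetSpace Γ) := CosetSpace.t2Space Γ
  have : LocallyCompactSpace (CosetSpace Γ) := CosetSpace.locallyCompactSpace Γ
  have : SecondCountableTopology (CosetSpace Γ) := CosetSpace.secondCountableTopology Γ
  have hlam1 := one_lt_abs_of_gPlus_eq hG hlam hplus
  obtain ⟨K, hK⟩ := exists_isOpen_isCoveredModulo_conj_subgroup a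
  simpa only [Real.log_inv, mul_neg, neg_neg] using
    hμ.hasBoxDimension.isProbabilityMeasure_and_le_measureEntropy hκ
      (expandingBoxes_tube bm b0 bp hlam1 hplus hspan hbm) (inv_pos.2 (one_pos.trans hlam1))
      (inv_le_one_of_one_le₀ hlam1.le) (measurableSet_smul_image_tube bm b0 bp)
      (CosetSpace.isOpenMap_smul_left Γ)
      (fun _ => CosetSpace.exists_nhds_forall_injOn_smul_of_isCompact Γ) hK hρ hpos

theorem mainTheorem4 {N : ℕ} (G : Subgroup (Matrix.SpecialLinearGroup (Fin N) ℝ))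
    (hG : IsClosed (G : Set (Matrix.SpecialLinearGroup (Fin N) ℝ)))
    (hconn : IsConnected (G : Set (Matrix.SpecialLinearGroup (Fin N) ℝ)))
    (Γ : Subgroup G) (hΓ : IsLattice Γ)
    (a : G) (ha : IsClassA hG a)
    (habel : ∀ g ∈ unstableHorospherical a, ∀ h ∈ unstableHorospherical a, g * h = h * g)
    (lam t : ℝ) (hlam : (Ad hG a).HasEigenvalue lam)
    (hplus : gPlus hG a = (Ad hG a).eigenspace lam) (ht : |lam| = Real.exp t)
    {nm nz np : ℕ}
    (bm : Module.Basis (Fin nm) ℝ (gMinus hG a))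
    (hbm : ∀ i, ∃ c : ℝ, Ad hG a (bm i) = c • (bm i : lieAlg hG))
    (b0 : Module.Basis (Fin nz) ℝ (gZero hG a))
    (bp : Module.Basis (Fin np) ℝ (gPlus hG a))
    (μ : Measure (CosetSpace Γ)) [IsProbabilityMeasure μ]
    (κ : ℝ) (hκ : 0 < κ) (hμ : HasLocalDimension bm b0 bp μ κ)
    (ρ : Measure (CosetSpace Γ)) [IsFiniteMeasureOnCompacts ρ]
    (hρ : IsWeakStarLimitPoint ρ (cesaroAverage (fun x => a • x) μ))
    (hpos : 0 < ρ Set.univ) :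
    IsProbabilityMeasure ((ρ Set.univ)⁻¹ • ρ) ∧
      MeasurePreserving (fun x : CosetSpace Γ => a • x)
        ((ρ Set.univ)⁻¹ • ρ) ((ρ Set.univ)⁻¹ • ρ) ∧
      ENNReal.ofReal (κ * t) ≤
        measureEntropy (fun x : CosetSpace Γ => a • x) ((ρ Set.univ)⁻¹ • ρ) := by
  have := hΓ.1
  simpa only [ht, Real.log_exp] using mainTheorem4_general G hG Γ a ha.gMinus_sup_gZero_sup_gPlus
    lam hlam hplus bm hbm b0 bp μ κ hκ.le hμ ρ hρ hpos
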